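/- Conventions. $\hat f(\xi)=\int_{\mathbb R}e^{-2\pi i x\xi}f(x)\,dx$, extended to $L^2(\mathbb R)$ by Plancherel; $\langle\xi\rangle=(1+|\xi|^2)^{1/2}$. For $0<\delta<1$ let $$\Sigma_\delta(\mathbb R)=\{f\in L^2(\mathbb R;\mathbb C)\;:\; |x|^\delta f\in L^2,\ |\xi|^\delta\hat f\in L^2\}.$$ For $f\in\Sigma_\delta(\mathbb R)$ let $u(\cdot,t)$, $\hat u(\xi,t)=e^{-\pi i t\xi^2}\hat f(\xi)$, be the solution of $\partial_t u=\frac i2\hbar\,\partial_x^2u$, $u(\cdot,0)=f$, with $\hbar=\frac1{2\pi}$, and let $$h_\delta[f](t)=\int_{\mathbb R}|x|^{2\delta}|u(x,t)|^2\,dx .$$ The pairing $\langle\hat h_\delta[f],\varphi\rangle:=\int_{\mathbb R}h_\delta[f](t)\,\hat\varphi(t)\,dt$ is the distributional Fourier transform of $h_\delta[f]$ applied to a test function $\varphi$. **Theorem.** Let $0<\delta<1$, and let $\zeta\in C_0^\infty(\mathbb R)$ be real-valued, even and nonnegative, with support in $(-1,1)$ and $\zeta=1$ in a neighbourhood of $0$;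 put $\zeta_\varepsilon(t)=\zeta(t/\varepsilon)$. For every $f\in\Sigma_\delta(\mathbb R)$ the integrals defining $h_\delta[f](t)$ ($t\in\mathbb R$) and $\langle\hat h_\delta[f],\zeta_\varepsilon\rangle$ ($\varepsilon>0$) converge absolutely. There are real constants $A$ (and $B$ in case 3) and, in cases 2 and 3, a measurable function $R:\mathbb R\to\mathbb R$, all depending only on $\zeta$ and $\delta$, such that for every $f\in\Sigma_\delta(\mathbb R)$, as $\varepsilon\to0^+$, the following holds. 1. If $\delta<\frac12$, then $$\langle\hat h_\delta[f],\zeta_\varepsilon\rangle=A\varepsilon^{-2\delta}\,\big\||\xi|^\delta\hat f\big\|_2^2+o(1).$$ 2. If $\delta=\frac12$, then $|R(\xi)|\le C\langle\xi\rangle^{-3}$ for some constant $C$ and all $\xi$, and $$\langle\hat h_\delta[f],\zeta_\varepsilon\rangle=A\varepsilon^{-1}\big\||\xi|^\delta\hat f\big\|_2^2+\int_{\mathbb R}|\hat f(\xi)|^2\,\varepsilon^{-\frac12}R(\xi/\sqrt\varepsilon)\,d\xi+o(1)=A\varepsilon^{-1}\big\||\xi|^\delta\hat f\big\|_2^2+O_\alpha(\varepsilon^{-\alpha})\quad\text{for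 every }\alpha>0.$$ 3. If $\delta>\frac12$, then $|R(\xi)|\le C\langle\xi\rangle^{2\delta-4}$ for some constant $C$ and all $\xi$, $f$ is integrable (so that $\hat f$ is continuous and $\hat f(0)$ is defined), and $$\langle\hat h_\delta[f],\zeta_\varepsilon\rangle=A\varepsilon^{-2\delta}\big\||\xi|^\delta\hat f\big\|_2^2+B\varepsilon^{\frac12-\delta}|\hat f(0)|^2+\int_{\mathbb R}\big(|\hat f(\xi)|^2-|\hat f(0)|^2\big)\varepsilon^{-\delta}R(\xi/\sqrt\varepsilon)\,d\xi+o(1)$$ $$=A\varepsilon^{-2\delta}\big\||\xi|^\delta\hat f\big\|_2^2+B\varepsilon^{\frac12-\delta}|\hat f(0)|^2+O\big(\varepsilon^{-\frac12(\delta-\frac12)}\big).$$ The implied constants and rates may depend on $f$, $\zeta$, $\delta$ (and $\alpha$). -/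

import Mathlib

open MeasureTheory Filter Topology Set Asymptotics
open scoped FourierTransform ContDiff

/-- Complex-valued `L²(ℝ)`. On it `𝓕` is the Plancherel extension of
`f ↦ ∫ exp (-2πi x ξ) f x dx`. -/
abbrev L2R : Type := Lp ℂ 2 (volume : Measure ℝ)

/-- `Σ_δ(ℝ)`: those `f ∈ L²(ℝ)` with `|x|^δ f ∈ L²` and `|ξ|^δ f̂ ∈ L²`. -/
def SigmaSpace (δ : ℝ) : Set L2R :=
  {f | MemLp (fun x : ℝ => ((|x| ^ δ : ℝ) : ℂ) * f x) 2 volume ∧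
       MemLp (fun ξ : ℝ => ((|ξ| ^ δ : ℝ) : ℂ) * (𝓕 f : L2R) ξ) 2 volume}

/-- The normalised constant `ħ = 1 / (2π)`. -/
noncomputable def hbar : ℝ := 1 / (2 * Real.pi)

/-- The Fourier symbol of the propagator `exp (i t ħ Δ / 2)`; the symbol of `Δ` is `-(2πξ)²`, so
this equals `exp (-πi t ξ²)`. -/
noncomputable def schrodingerSymbol (t ξ : ℝ) : ℂ :=
  Complex.exp (((t * (hbar / 2 * -(2 * Real.pi * ξ) ^ 2) : ℝ) : ℂ) * Complex.I)

theorem schrodingerSymbol_eq (t ξ : ℝ) :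
    schrodingerSymbol t ξ = Complex.exp (((-(Real.pi * t * ξ ^ 2) : ℝ) : ℂ) * Complex.I) := by
  have h : t * (hbar / 2 * -(2 * Real.pi * ξ) ^ 2) = -(Real.pi * t * ξ ^ 2) := by
    unfold hbar
    field_simp
  rw [schrodingerSymbol, h]

theorem norm_schrodingerSymbol (t ξ : ℝ) : ‖schrodingerSymbol t ξ‖ = 1 :=
  Complex.norm_exp_ofReal_mul_I _

theorem continuous_schrodingerSymbol (t : ℝ) : Continuous (schrodingerSymbol t) := by
  unfold schrodingerSymbol
  fun_prop

theorem memLp_schrodingerSymbol_mul (t : ℝ) (g : L2R) :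
    MemLp (fun ξ : ℝ => schrodingerSymbol t ξ * g ξ) 2 volume := by
  refine (Lp.memLp g).of_le
    ((continuous_schrodingerSymbol t).aestronglyMeasurable.mul (Lp.aestronglyMeasurable g)) ?_
  filter_upwards with ξ
  simp [norm_schrodingerSymbol]

/-- The solution `u(·, t) = exp (i t ħ Δ / 2) f` in `L²(ℝ)` of `∂ₜ u = (i/2) ħ ∂ₓ² u`,
`u(·, 0) = f`. -/
noncomputable def schrodingerSol (f : L2R) (t : ℝ) : L2R :=
  𝓕⁻ ((memLp_schrodingerSymbol_mul t (𝓕 f)).toLp _)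

/-- The dispersion functional `h_δ[f](t) = ∫ |x|^(2δ) |u(x, t)|² dx`. -/
noncomputable def dispersion (δ : ℝ) (f : L2R) (t : ℝ) : ℝ :=
  ∫ x : ℝ, |x| ^ (2 * δ) * ‖schrodingerSol f t x‖ ^ 2

/-- The pairing `⟨ĥ, φ⟩ = ⟨h, φ̂⟩ = ∫ h(t) φ̂(t) dt` of the distributional Fourier transform of a
function `h` with a real test function `φ`. -/
noncomputable def fourierPairing (h : ℝ → ℝ) (φ : ℝ → ℝ) : ℂ :=
  ∫ t : ℝ, (h t : ℂ) * 𝓕 (fun τ : ℝ => (φ τ : ℂ)) t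

/-- Symmetric nonnegative smooth cutoffs supported in `(-1, 1)` and equal to `1` near `0`. -/
structure IsSymmCutoff (ζ : ℝ → ℝ) : Prop where
  smooth : ContDiff ℝ ∞ ζ
  symm : ∀ t, ζ (-t) = ζ t
  nonneg : ∀ t, 0 ≤ ζ t
  supp : tsupport ζ ⊆ Ioo (-1) 1
  eq_one : ∀ᶠ t in 𝓝 (0 : ℝ), ζ t = 1

/-- The rescaled cutoff `ζ_ε(t) = ζ(t / ε)`. -/
noncomputable def rescale (ζ : ℝ → ℝ) (ε : ℝ) : ℝ → ℝ := fun t => ζ (t / ε)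

/-- `‖|ξ|^δ f̂‖₂²`. -/
noncomputable def fracEnergy (δ : ℝ) (f : L2R) : ℝ :=
  ∫ ξ : ℝ, (|ξ| ^ δ * ‖(𝓕 f : L2R) ξ‖) ^ 2

/-- The value at `0` of the Fourier integral of an integrable `f`, i.e. of the continuous
representative of `f̂`. -/
noncomputable def fourierAtZero (f : L2R) : ℂ := 𝓕 (f : ℝ → ℂ) 0

/-- The Japanese bracket `⟨ξ⟩ = (1 + |ξ|²)^(1/2)`. -/
noncomputable def japan (ξ : ℝ) : ℝ := Real.sqrt (1 + |ξ| ^ 2)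

/-! Write g for the Fourier transform of f, κ for `gagliardoConst δ` and e(x) = exp(2πix). By the
Aronszajn–Slobodeckij identity (`gagliardo_fourier`), κ h_δ(t) is the double integral of |û(ξ+z,t) -
û(ξ,t)|² |z|^(-1-2δ). The propagator enters this difference only through the phase e(-tσ) with σ =
ξz + z²/2. Integrating in t against the transform of an even φ with φ(0) = 1 is therefore Fourier
inversion: the cross terms acquire the factor φ(σ), and κ⟨ĥ,φ⟩ is the double integral of { |g(ξ+z) -
g(ξ)|² φ(σ) + (|g(ξ+z)|² + |g(ξ)|²)(1 - φ(σ)) } |z|^(-1-2δ).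

For φ = ζ_ε the first term tends to 0 by dominated convergence, since σ ≠ 0 almost everywhere. The
involution (ξ,z) ↦ (ξ+z,-z) turns the second into 2∫|g|² K_ε, where K_ε(ξ) = ε^(-δ) K(ξ/√ε) by
parabolic scaling (`cutoffKernel_rescale`). Substituting w = xz gives K(x) = c|x|^(2δ) + remainder,
and c|x|^(2δ) produces the leading term. The remainder compares ζ(w) with ζ(w + w²/(2x²)). Averaging
over w ↦ -w leaves a second difference, of size |x|^(2δ-4), and a contribution from the second zero
of the phase, of size |x|^(-2-2δ) (`exists_abs_kernelRemainder_le`).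

What is left is the integral of |g|² against the rescaled remainder, which concentrates at ξ = 0.
For δ < 1/2 it vanishes in the limit by a fractional Hardy inequality
(`integrable_rpow_neg_mul_norm_sq`). At δ = 1/2 only the Hardy orders below 1/2 are available, which
costs ε^(-α). For δ > 1/2, g is Hölder of order δ - 1/2 at the origin
(`exists_norm_fourier_sub_fourier_zero_le`), so |g(0)|² can be split off, with B the integral of the
remainder profile. -/

/-! ### The Fourier transform on L²: integrable functions, modulations, Plancherel. -/

theorem integral_schwartz_mul_fourier (f : L2R) (φ : SchwartzMap ℝ ℂ) :
    ∫ ξ, φ ξ * (𝓕 f : L2R) ξ = ∫ x, 𝓕 (φ : ℝ → ℂ) x * f x := by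
  have h := congrArg (fun T => T φ) (Lp.fourier_toTemperedDistribution_eq f)
  simp only [TemperedDistribution.fourier_apply, Lp.toTemperedDistribution_apply, smul_eq_mul,
    SchwartzMap.fourier_coe] at h
  exact h.symm

/-- Smooth compactly supported functions are Schwartz and separate locally integrable functions, so
the duality formula determines the transform almost everywhere. -/
theorem fourier_ae_eq_of_integral_schwartz_mul {f : L2R} {v : ℝ → ℂ} (hv : LocallyIntegrable v)
    (h : ∀ φ : SchwartzMap ℝ ℂ, ∫ ξ, φ ξ * v ξ = ∫ x, 𝓕 (φ : ℝ → ℂ) x * f x) :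
    (𝓕 f : L2R) =ᵐ[volume] v := by
  refine ae_eq_of_integral_contDiff_smul_eq
    ((Lp.memLp (𝓕 f : L2R)).locallyIntegrable (by norm_num)) hv fun ψ hψ hc => ?_
  have hc' : HasCompactSupport (fun x => (ψ x : ℂ)) := hc.comp_left Complex.ofReal_zero
  have hs : ContDiff ℝ ∞ (fun x => (ψ x : ℂ)) := Complex.ofRealCLM.contDiff.comp hψ
  have := (integral_schwartz_mul_fourier f (hc'.toSchwartzMap hs)).trans (h _).symm
  simpa [Complex.real_smul] using this

theorem fourier_ae_eq_of_integrable {f : L2R} (hf : Integrable f) :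
    (𝓕 f : L2R) =ᵐ[volume] 𝓕 (f : ℝ → ℂ) := by
  have hc : Continuous (𝓕 (f : ℝ → ℂ)) :=
    VectorFourier.fourierIntegral_continuous Real.continuous_fourierChar
      (by exact continuous_inner) hf
  refine fourier_ae_eq_of_integral_schwartz_mul hc.locallyIntegrable fun φ => ?_
  have := VectorFourier.integral_fourierIntegral_smul_eq_flip (L := innerₗ ℝ) (μ := volume)
    (ν := volume) Real.continuous_fourierChar continuous_inner φ.integrable hf
  rw [flip_innerₗ] at this
  exact this.symm

theorem memLp_fourierChar_mul (f : L2R) (z : ℝ) :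
    MemLp (fun x : ℝ => (Real.fourierChar (-(x * z)) : ℂ) * f x) 2 volume := by
  refine (Lp.memLp f).of_le (Continuous.aestronglyMeasurable (by fun_prop) |>.mul
    (Lp.aestronglyMeasurable f)) ?_
  filter_upwards with ξ
  rw [norm_mul, Circle.norm_coe, one_mul]

/-- By duality the shift moves to the test function: the transform of φ(· - z) is e(-xz) times the
transform of φ. -/
theorem fourier_fourierChar_mul (f : L2R) (z : ℝ) :
    (𝓕 ((memLp_fourierChar_mul f z).toLp _) : L2R) =ᵐ[volume] fun ξ => (𝓕 f : L2R) (ξ + z) := by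
  have hmp := measurePreserving_add_right (volume : Measure ℝ) z
  refine fourier_ae_eq_of_integral_schwartz_mul
    (((Lp.memLp (𝓕 f : L2R)).comp_measurePreserving hmp).locallyIntegrable (by norm_num))
    fun φ => ?_
  have h1 := integral_schwartz_mul_fourier f (SchwartzMap.compSubConstCLM ℂ z φ)
  have h2 : ∫ ξ, φ ξ * (𝓕 f : L2R) (ξ + z) = ∫ ξ, φ (ξ - z) * (𝓕 f : L2R) ξ := by
    rw [← integral_add_right_eq_self (fun ξ => φ (ξ - z) * (𝓕 f : L2R) ξ) z]
    simp
  simp only [SchwartzMap.compSubConstCLM_apply] at h1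
  rw [h2, h1]
  refine integral_congr_ae ?_
  filter_upwards [(memLp_fourierChar_mul f z).coeFn_toLp] with x hx
  rw [hx, ← mul_assoc]
  congr 1
  simp only [Real.fourier_eq']
  rw [← integral_add_right_eq_self _ z, mul_comm, Real.fourierChar_apply, ← integral_mul_const]
  congr 1 with y
  simp only [smul_eq_mul, RCLike.inner_apply, conj_trivial, SchwartzMap.compSubConstCLM_apply,
    add_sub_cancel_right]
  rw [mul_right_comm _ (φ y), ← Complex.exp_add]
  push_cast
  ring_nf

theorem lintegral_norm_sq_eq_ofReal_norm_sq (f : L2R) :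
    ∫⁻ x, ENNReal.ofReal (‖f x‖ ^ 2) = ENNReal.ofReal (‖f‖ ^ 2) := by
  rw [← ofReal_integral_eq_lintegral_ofReal
    (by simpa using (Lp.memLp f).integrable_norm_rpow (by norm_num) (by norm_num))
    (ae_of_all _ fun x => by positivity), Lp.norm_def,
    (Lp.memLp f).eLpNorm_eq_integral_rpow_norm (by norm_num) (by norm_num),
    ENNReal.toReal_ofReal (by positivity)]
  congr 1
  rw [← Real.rpow_natCast, ← Real.rpow_mul (by positivity)]
  simp

theorem lintegral_norm_sq_fourier (f : L2R) :
    ∫⁻ ξ, ENNReal.ofReal (‖(𝓕 f : L2R) ξ‖ ^ 2) = ∫⁻ x, ENNReal.ofReal (‖f x‖ ^ 2) := by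
  rw [lintegral_norm_sq_eq_ofReal_norm_sq, lintegral_norm_sq_eq_ofReal_norm_sq, Lp.norm_fourier_eq]

/-- Plancherel for the difference of a translate of `𝓕 f` and `𝓕 f`. -/
theorem lintegral_norm_sq_fourier_sub (f : L2R) (z : ℝ) :
    ∫⁻ ξ, ENNReal.ofReal (‖(𝓕 f : L2R) (ξ + z) - (𝓕 f : L2R) ξ‖ ^ 2) =
      ∫⁻ x, ENNReal.ofReal (‖(Real.fourierChar (-(x * z)) : ℂ) - 1‖ ^ 2 * ‖f x‖ ^ 2) := by
  have h := lintegral_norm_sq_fourier ((memLp_fourierChar_mul f z).toLp _ - f)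
  have hs (u v : L2R) : (𝓕 (u - v) : L2R) = 𝓕 u - 𝓕 v :=
    map_sub (Lp.fourierTransformₗᵢ ℝ ℂ) u v
  rw [hs] at h
  refine (lintegral_congr_ae ?_).trans (h.trans (lintegral_congr_ae ?_))
  · filter_upwards [fourier_fourierChar_mul f z, Lp.coeFn_sub
      (𝓕 ((memLp_fourierChar_mul f z).toLp _) : L2R) (𝓕 f : L2R)] with ξ h1 h2
    rw [h2, Pi.sub_apply, h1]
  · filter_upwards [(memLp_fourierChar_mul f z).coeFn_toLp, Lp.coeFn_sub
      ((memLp_fourierChar_mul f z).toLp _) f] with x h1 h2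
    rw [h2, Pi.sub_apply, h1, ← mul_pow, ← norm_mul, sub_one_mul]

/-! ### The homogeneous weight and the Aronszajn–Slobodeckij identity. -/

/-- The homogeneous weight `|z|^(-1-2s)`. -/
noncomputable def singWeight (s z : ℝ) : ℝ := |z| ^ (-1 - 2 * s)

theorem singWeight_nonneg (s z : ℝ) : 0 ≤ singWeight s z := by
  unfold singWeight; positivity

theorem singWeight_neg (s z : ℝ) : singWeight s (-z) = singWeight s z := by
  simp [singWeight]

@[fun_prop]
theorem measurable_singWeight (s : ℝ) : Measurable (singWeight s) := by
  unfold singWeight; fun_prop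

theorem singWeight_mul (s : ℝ) {x : ℝ} (hx : x ≠ 0) (z : ℝ) :
    singWeight s z = |x| ^ (1 + 2 * s) * singWeight s (x * z) := by
  unfold singWeight
  rw [abs_mul, Real.mul_rpow (abs_nonneg _) (abs_nonneg _), ← mul_assoc,
    ← Real.rpow_add (abs_pos.2 hx)]
  ring_nf
  simp

/-- The weight has degree -1-2s and dz has degree 1, so a dilation by x leaves |x|^(2s). -/
theorem integral_comp_mul_singWeight (s : ℝ) (F : ℝ → ℝ) {x : ℝ} (hx : x ≠ 0) :
    ∫ z, F (x * z) * singWeight s z = |x| ^ (2 * s) * ∫ z, F z * singWeight s z := by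
  have h : ∀ z, F (x * z) * singWeight s z =
      |x| ^ (1 + 2 * s) * (fun y => F y * singWeight s y) (x * z) := fun z => by
    rw [singWeight_mul s hx z]; ring
  simp_rw [h]
  rw [integral_const_mul, Measure.integral_comp_mul_left (fun y => F y * singWeight s y),
    smul_eq_mul, ← mul_assoc,
    Real.rpow_add (abs_pos.2 hx), abs_inv, Real.rpow_one]
  field_simp [abs_ne_zero.2 hx]

theorem integrable_comp_mul_singWeight {s : ℝ} {F : ℝ → ℝ} {x : ℝ} (hx : x ≠ 0)
    (hF : Integrable fun z => F z * singWeight s z) :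
    Integrable fun z => F (x * z) * singWeight s z := by
  have h : ∀ z, F (x * z) * singWeight s z =
      |x| ^ (1 + 2 * s) * (fun y => F y * singWeight s y) (x * z) := fun z => by
    rw [singWeight_mul s hx z]; ring
  simp_rw [h]
  exact (hF.comp_mul_left' hx).const_mul _

/-- Near 0 the integrand is |z|^(1-2s), integrable because s < 1; at infinity it is |z|^(-1-2s),
integrable because s > 0. -/
theorem integrable_min_sq_mul_singWeight {s : ℝ} (hs₀ : 0 < s) (hs₁ : s < 1) :
    Integrable fun z : ℝ => min 1 |z| ^ 2 * singWeight s z := by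
  have key : IntegrableOn (fun z : ℝ => min 1 |z| ^ 2 * singWeight s z) (Ioi 0) := by
    rw [← Ioc_union_Ioi_eq_Ioi zero_le_one, integrableOn_union]
    constructor
    · have h : IntegrableOn (fun z : ℝ => z ^ (1 - 2 * s)) (Ioc 0 1) := by
        rw [← intervalIntegrable_iff_integrableOn_Ioc_of_le zero_le_one]
        exact intervalIntegral.intervalIntegrable_rpow' (by linarith)
      refine h.congr_fun (fun z hz => ?_) measurableSet_Ioc
      simp only [singWeight, abs_of_pos hz.1, min_eq_right hz.2]
      rw [← Real.rpow_natCast, ← Real.rpow_add hz.1]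
      push_cast; ring_nf
    · refine (integrableOn_Ioi_rpow_of_lt (a := -1 - 2 * s) (by linarith) one_pos).congr_fun
        (fun z hz => ?_) measurableSet_Ioi
      have hz' : (1 : ℝ) < z := hz
      simp only [singWeight, abs_of_pos (one_pos.trans hz'), min_eq_left hz'.le]
      ring
  rw [← integrableOn_univ, ← Iic_union_Ioi (a := (0 : ℝ)), integrableOn_union]
  refine ⟨?_, key⟩
  rw [integrableOn_Iic_iff_integrableOn_Iio]
  have := key.comp_neg
  simpa [singWeight_neg, IntegrableOn] using this

theorem norm_fourierChar_sub_one_le (x : ℝ) :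
    ‖(Real.fourierChar x : ℂ) - 1‖ ≤ 2 * Real.pi * min 1 |x| := by
  rw [mul_min_of_nonneg _ _ (by positivity), le_min_iff]
  constructor
  · refine (norm_sub_le _ _).trans ?_
    rw [Circle.norm_coe, norm_one]
    linarith [Real.pi_gt_three]
  · rw [Real.fourierChar_apply, mul_comm _ Complex.I]
    refine (Real.norm_exp_I_mul_ofReal_sub_one_le).trans (le_of_eq ?_)
    rw [Real.norm_eq_abs, abs_mul, abs_of_pos (by positivity : 0 < 2 * Real.pi)]

theorem integrable_norm_fourierChar_sub_one_sq_mul_singWeight {s : ℝ} (hs₀ : 0 < s) (hs₁ : s < 1) :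
    Integrable fun z : ℝ => ‖(Real.fourierChar (-z) : ℂ) - 1‖ ^ 2 * singWeight s z := by
  refine ((integrable_min_sq_mul_singWeight hs₀ hs₁).const_mul ((2 * Real.pi) ^ 2)).mono'
    (by fun_prop) (ae_of_all _ fun z => ?_)
  have h0 := singWeight_nonneg s z
  rw [Real.norm_of_nonneg (by positivity), ← mul_assoc, ← mul_pow]
  gcongr
  simpa using norm_fourierChar_sub_one_le (-z)

/-- The constant in the Aronszajn–Slobodeckij identity. -/
noncomputable def gagliardoConst (s : ℝ) : ℝ :=
  ∫ z : ℝ, ‖(Real.fourierChar (-z) : ℂ) - 1‖ ^ 2 * singWeight s z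

/-- The character equals 1 only at integers, so the integrand is nonzero on (0,1). Positivity allows
division by the constant. -/
theorem gagliardoConst_pos {s : ℝ} (hs₀ : 0 < s) (hs₁ : s < 1) : 0 < gagliardoConst s := by
  unfold gagliardoConst
  rw [integral_pos_iff_support_of_nonneg
    (fun z => mul_nonneg (sq_nonneg _) (singWeight_nonneg s z))
    (integrable_norm_fourierChar_sub_one_sq_mul_singWeight hs₀ hs₁)]
  refine lt_of_lt_of_le (b := volume (Ioo (0 : ℝ) 1)) (by simp) (measure_mono fun z hz => ?_)
  have h1 : (Real.fourierChar (-z) : ℂ) ≠ 1 := by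
    rw [Real.fourierChar_apply, Ne, Complex.exp_eq_one_iff]
    rintro ⟨n, hn⟩
    have h2 : (2 * Real.pi * Complex.I) ≠ 0 := Complex.two_pi_I_ne_zero
    have h3 : ((-z : ℝ) : ℂ) = n := by
      apply mul_right_cancel₀ h2
      rw [← hn]; push_cast; ring
    have h4 : (-z : ℝ) = n := by exact_mod_cast h3
    have h5 : ((-1 : ℤ) : ℝ) < n := by rw [← h4]; push_cast; linarith [hz.2]
    have h6 : (n : ℝ) < ((0 : ℤ) : ℝ) := by rw [← h4]; push_cast; linarith [hz.1]
    rw [Int.cast_lt] at h5 h6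
    omega
  have h7 : singWeight s z ≠ 0 := by
    unfold singWeight
    exact (Real.rpow_pos_of_pos (abs_pos.2 hz.1.ne') _).ne'
  exact mul_ne_zero (pow_ne_zero _ (norm_ne_zero_iff.2 (sub_ne_zero.2 h1))) h7

/-- The Gagliardo–Slobodeckij energy. -/
noncomputable def gagliardo (s : ℝ) (g : ℝ → ℂ) : ENNReal :=
  ∫⁻ p : ℝ × ℝ, ENNReal.ofReal (‖g (p.1 + p.2) - g p.1‖ ^ 2 * singWeight s p.2)

theorem lintegral_norm_fourierChar_sub_one {s : ℝ} (hs₀ : 0 < s) (hs₁ : s < 1) (x : ℝ) :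
    ∫⁻ z, ENNReal.ofReal (‖(Real.fourierChar (-(x * z)) : ℂ) - 1‖ ^ 2 * singWeight s z) =
      ENNReal.ofReal (gagliardoConst s * |x| ^ (2 * s)) := by
  rcases eq_or_ne x 0 with rfl | hx
  · simp [Real.zero_rpow (by positivity : 2 * s ≠ 0)]
  · have hi := integrable_norm_fourierChar_sub_one_sq_mul_singWeight hs₀ hs₁
    rw [← ofReal_integral_eq_lintegral_ofReal
      (integrable_comp_mul_singWeight
        (F := fun z => ‖(Real.fourierChar (-z) : ℂ) - 1‖ ^ 2) hx hi)
      (ae_of_all _ fun z => mul_nonneg (sq_nonneg _) (singWeight_nonneg s z)),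
      integral_comp_mul_singWeight s (fun z => ‖(Real.fourierChar (-z) : ℂ) - 1‖ ^ 2) hx,
      mul_comm]
    rfl

/-- The Aronszajn–Slobodeckij identity. -/
theorem gagliardo_fourier {s : ℝ} (hs₀ : 0 < s) (hs₁ : s < 1) (f : L2R) :
    gagliardo s (𝓕 f : L2R) =
      ∫⁻ x, ENNReal.ofReal (gagliardoConst s * (|x| ^ (2 * s) * ‖f x‖ ^ 2)) := by
  have hm : Measurable (f : ℝ → ℂ) := (Lp.stronglyMeasurable f).measurable
  have hg : Measurable ((𝓕 f : L2R) : ℝ → ℂ) := (Lp.stronglyMeasurable _).measurable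
  unfold gagliardo
  rw [Measure.volume_eq_prod, lintegral_prod_symm' _ (by fun_prop)]
  have h1 : ∀ z : ℝ, ∫⁻ ξ, ENNReal.ofReal (‖(𝓕 f : L2R) (ξ + z) - (𝓕 f : L2R) ξ‖ ^ 2 *
      singWeight s z) = ∫⁻ x, ENNReal.ofReal
        (‖f x‖ ^ 2 * (‖(Real.fourierChar (-(x * z)) : ℂ) - 1‖ ^ 2 * singWeight s z)) := fun z => by
    simp_rw [← mul_assoc, mul_comm (‖f _‖ ^ 2), ENNReal.ofReal_mul' (singWeight_nonneg s z)]
    rw [lintegral_mul_const' _ _ (by simp), lintegral_mul_const' _ _ (by simp),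
      lintegral_norm_sq_fourier_sub]
  simp_rw [h1]
  rw [lintegral_lintegral_swap (by fun_prop)]
  refine lintegral_congr fun x => ?_
  simp_rw [ENNReal.ofReal_mul (sq_nonneg ‖f x‖)]
  rw [lintegral_const_mul' _ _ (by simp), lintegral_norm_fourierChar_sub_one hs₀ hs₁,
    ← ENNReal.ofReal_mul (sq_nonneg _)]
  congr 1; ring

/-! ### The phase and its integrability against the weight. -/

theorem min_one_abs_add_le (a b : ℝ) : min 1 |a + b| ≤ min 1 |a| + min 1 |b| := by
  have h := abs_add_le a b
  have ha := abs_nonneg a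
  have hb := abs_nonneg b
  rcases min_cases 1 |a| with h1 | h1 <;> rcases min_cases 1 |b| with h2 | h2 <;>
    rcases min_cases 1 |a + b| with h3 | h3 <;> linarith

/-- Half the difference of squares `((ξ + z)² - ξ²) / 2`. -/
noncomputable def halfSqDiff (ξ z : ℝ) : ℝ := ξ * z + z ^ 2 / 2

/-- Truncation at 1 is subadditive and reduces z²/2 to |z|. This separates a piece homogeneous in ξz
from a piece independent of ξ. -/
theorem min_halfSqDiff_sq_le (ξ z : ℝ) :
    min 1 |halfSqDiff ξ z| ^ 2 ≤ 2 * min 1 |ξ * z| ^ 2 + 2 * min 1 |z| ^ 2 := by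
  have h1 := min_one_abs_add_le (ξ * z) (z ^ 2 / 2)
  have h2 : min 1 |z ^ 2 / 2| ≤ min 1 |z| := by
    have hz := abs_nonneg z
    rw [abs_of_nonneg (by positivity), ← sq_abs]
    rcases le_total |z| 1 with h | h
    · rw [min_eq_right h]
      exact (min_le_right _ _).trans (by nlinarith)
    · rw [min_eq_left h]
      exact min_le_left _ _
  have h3 : 0 ≤ min 1 |halfSqDiff ξ z| := by positivity
  have h4 : min 1 |halfSqDiff ξ z| ≤ min 1 |ξ * z| + min 1 |z| := h1.trans (by linarith)
  nlinarith [sq_nonneg (min 1 |ξ * z| - min 1 |z|), pow_le_pow_left₀ h3 h4 2]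

theorem integrable_min_halfSqDiff {s : ℝ} (hs₀ : 0 < s) (hs₁ : s < 1) (ξ : ℝ) :
    Integrable fun z : ℝ => min 1 |halfSqDiff ξ z| ^ 2 * singWeight s z := by
  have h0 := integrable_min_sq_mul_singWeight hs₀ hs₁
  have hm : Measurable fun z => min 1 |halfSqDiff ξ z| ^ 2 * singWeight s z := by
    unfold halfSqDiff; fun_prop
  have h1 : Integrable fun z : ℝ => min 1 |ξ * z| ^ 2 * singWeight s z := by
    rcases eq_or_ne ξ 0 with rfl | h
    · simp
    · exact integrable_comp_mul_singWeight (F := fun z => min 1 |z| ^ 2) h h0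
  refine ((h1.const_mul 2).add (h0.const_mul 2)).mono' hm.aestronglyMeasurable
    (ae_of_all _ fun z => ?_)
  have hw := singWeight_nonneg s z
  rw [Real.norm_of_nonneg (by positivity), Pi.add_apply, ← mul_assoc, ← mul_assoc, ← add_mul]
  exact mul_le_mul_of_nonneg_right (min_halfSqDiff_sq_le ξ z) hw

/-- The homogeneous piece scales to |ξ|^(2s). This growth is what the weighted L² condition on the
transform pays for. -/
theorem exists_integral_min_halfSqDiff_le {s : ℝ} (hs₀ : 0 < s) (hs₁ : s < 1) :
    ∃ C : ℝ, 0 ≤ C ∧ ∀ ξ, ∫ z, min 1 |halfSqDiff ξ z| ^ 2 * singWeight s z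
      ≤ C * (1 + |ξ| ^ (2 * s)) := by
  have h0 := integrable_min_sq_mul_singWeight hs₀ hs₁
  refine ⟨2 * ∫ z : ℝ, min 1 |z| ^ 2 * singWeight s z, mul_nonneg zero_le_two
    (integral_nonneg fun z => mul_nonneg (sq_nonneg _) (singWeight_nonneg s z)), fun ξ => ?_⟩
  have h1 : Integrable (fun z : ℝ => min 1 |ξ * z| ^ 2 * singWeight s z) ∧
      ∫ z : ℝ, min 1 |ξ * z| ^ 2 * singWeight s z =
        |ξ| ^ (2 * s) * ∫ z : ℝ, min 1 |z| ^ 2 * singWeight s z := by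
    rcases eq_or_ne ξ 0 with rfl | h
    · simp [Real.zero_rpow (by positivity : 2 * s ≠ 0)]
    · exact ⟨integrable_comp_mul_singWeight (F := fun z => min 1 |z| ^ 2) h h0,
        integral_comp_mul_singWeight s (fun z => min 1 |z| ^ 2) h⟩
  calc _ ≤ ∫ z : ℝ, (2 * (min 1 |ξ * z| ^ 2 * singWeight s z)
        + 2 * (min 1 |z| ^ 2 * singWeight s z)) := by
        refine integral_mono (integrable_min_halfSqDiff hs₀ hs₁ ξ)
          ((h1.1.const_mul 2).add (h0.const_mul 2)) fun z => ?_
        simp only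
        rw [← mul_assoc, ← mul_assoc, ← add_mul]
        exact mul_le_mul_of_nonneg_right (min_halfSqDiff_sq_le ξ z) (singWeight_nonneg s z)
    _ = _ := by
        rw [integral_add (h1.1.const_mul 2) (h0.const_mul 2), integral_const_mul,
          integral_const_mul, h1.2]
        ring

/-! ### The Gagliardo integrand along the evolution, and the dispersion functional. -/

/-- Measurable functions with `g`, `|ξ|^s g` and the Gagliardo difference quotient of order `s`
square integrable. -/
structure IsSobolevWeighted (s : ℝ) (g : ℝ → ℂ) : Prop where
  meas : Measurable g
  sq : Integrable fun ξ => ‖g ξ‖ ^ 2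
  weighted : Integrable fun ξ => |ξ| ^ (2 * s) * ‖g ξ‖ ^ 2
  diff : Integrable fun p : ℝ × ℝ => ‖g (p.1 + p.2) - g p.1‖ ^ 2 * singWeight s p.2

theorem IsSobolevWeighted.integrable_min {s : ℝ} (hs₀ : 0 < s) (hs₁ : s < 1) {g : ℝ → ℂ}
    (hg : IsSobolevWeighted s g) :
    Integrable fun p : ℝ × ℝ =>
      ‖g p.1‖ ^ 2 * (min 1 |halfSqDiff p.1 p.2| ^ 2 * singWeight s p.2) := by
  obtain ⟨C, hC, hle⟩ := exists_integral_min_halfSqDiff_le hs₀ hs₁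
  have hgm := hg.meas
  have hm : Measurable fun p : ℝ × ℝ =>
      ‖g p.1‖ ^ 2 * (min 1 |halfSqDiff p.1 p.2| ^ 2 * singWeight s p.2) := by
    unfold halfSqDiff; fun_prop
  rw [Measure.volume_eq_prod, integrable_prod_iff hm.aestronglyMeasurable]
  refine ⟨ae_of_all _ fun ξ => (integrable_min_halfSqDiff hs₀ hs₁ ξ).const_mul (‖g ξ‖ ^ 2), ?_⟩
  refine ((hg.sq.add hg.weighted).const_mul C).mono'
    hm.aestronglyMeasurable.norm.integral_prod_right' (ae_of_all _ fun ξ => ?_)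
  rw [Real.norm_of_nonneg (by positivity)]
  have : ∀ z, ‖‖g ξ‖ ^ 2 * (min 1 |halfSqDiff ξ z| ^ 2 * singWeight s z)‖ =
      ‖g ξ‖ ^ 2 * (min 1 |halfSqDiff ξ z| ^ 2 * singWeight s z) := fun z =>
    Real.norm_of_nonneg (mul_nonneg (sq_nonneg _)
      (mul_nonneg (sq_nonneg _) (singWeight_nonneg s z)))
  simp only [this]
  rw [integral_const_mul, Pi.add_apply]
  nlinarith [mul_le_mul_of_nonneg_left (hle ξ) (sq_nonneg ‖g ξ‖)]

/-- The symbols at ξ + z and ξ differ by a character of t whose frequency is `halfSqDiff`; this is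
what makes the time integral a Fourier inversion. -/
theorem schrodingerSymbol_add (t ξ z : ℝ) :
    schrodingerSymbol t (ξ + z) =
      Real.fourierChar (-(t * halfSqDiff ξ z)) * schrodingerSymbol t ξ := by
  rw [schrodingerSymbol_eq, schrodingerSymbol_eq, Real.fourierChar_apply, ← Complex.exp_add,
    ← add_mul, ← Complex.ofReal_add]
  unfold halfSqDiff
  congr 3
  ring

theorem measurable_schrodingerSymbol : Measurable fun q : ℝ × ℝ => schrodingerSymbol q.1 q.2 := by
  unfold schrodingerSymbol
  fun_prop

theorem norm_schrodingerSymbol_mul_sub (g : ℝ → ℂ) (t ξ z : ℝ) :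
    ‖schrodingerSymbol t (ξ + z) * g (ξ + z) - schrodingerSymbol t ξ * g ξ‖ =
      ‖Real.fourierChar (-(t * halfSqDiff ξ z)) * g (ξ + z) - g ξ‖ := by
  rw [schrodingerSymbol_add, mul_right_comm, mul_comm _ (schrodingerSymbol t ξ), ← mul_sub,
    norm_mul, norm_schrodingerSymbol, one_mul]

/-- The difference splits into that of g and a phase error of size min(1, |tσ|). The growth in time
is at most quadratic, hence harmless against a Schwartz function of t. -/
theorem norm_schrodingerSymbol_mul_sub_sq_le (g : ℝ → ℂ) (t ξ z : ℝ) :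
    ‖schrodingerSymbol t (ξ + z) * g (ξ + z) - schrodingerSymbol t ξ * g ξ‖ ^ 2 ≤
      (1 + t ^ 2) * (2 * ‖g (ξ + z) - g ξ‖ ^ 2
        + 8 * Real.pi ^ 2 * (‖g ξ‖ ^ 2 * min 1 |halfSqDiff ξ z| ^ 2)) := by
  rw [norm_schrodingerSymbol_mul_sub]
  set c : ℂ := (Real.fourierChar (-(t * halfSqDiff ξ z)) : ℂ) with hc
  have hc1 : ‖c‖ = 1 := Circle.norm_coe _
  have h1 : ‖c * g (ξ + z) - g ξ‖ ≤ ‖g (ξ + z) - g ξ‖ + ‖c - 1‖ * ‖g ξ‖ := by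
    have : c * g (ξ + z) - g ξ = c * (g (ξ + z) - g ξ) + (c - 1) * g ξ := by ring
    rw [this]
    refine (norm_add_le _ _).trans ?_
    rw [norm_mul, norm_mul, hc1, one_mul]
  have h2 : ‖c - 1‖ ^ 2 ≤ (1 + t ^ 2) * (4 * Real.pi ^ 2 * min 1 |halfSqDiff ξ z| ^ 2) := by
    have h3 := norm_fourierChar_sub_one_le (-(t * halfSqDiff ξ z))
    rw [← hc, abs_neg, abs_mul] at h3
    have h4 : min 1 (|t| * |halfSqDiff ξ z|) ^ 2 ≤ (1 + t ^ 2) * min 1 |halfSqDiff ξ z| ^ 2 := by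
      rcases le_total 1 |halfSqDiff ξ z| with h | h
      · rw [min_eq_left h]
        have : min 1 (|t| * |halfSqDiff ξ z|) ^ 2 ≤ 1 ^ 2 :=
          pow_le_pow_left₀ (by positivity) (min_le_left _ _) 2
        nlinarith [sq_nonneg t]
      · rw [min_eq_right h]
        have : min 1 (|t| * |halfSqDiff ξ z|) ^ 2 ≤ (|t| * |halfSqDiff ξ z|) ^ 2 :=
          pow_le_pow_left₀ (by positivity) (min_le_right _ _) 2
        rw [mul_pow, sq_abs t] at this
        nlinarith [sq_nonneg |halfSqDiff ξ z|]
    have h5 := pow_le_pow_left₀ (norm_nonneg _) h3 2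
    rw [mul_pow] at h5
    nlinarith [mul_le_mul_of_nonneg_left h4 (by positivity : 0 ≤ (2 * Real.pi) ^ 2)]
  have h6 := pow_le_pow_left₀ (norm_nonneg _) h1 2
  have h7 := mul_le_mul_of_nonneg_right h2 (sq_nonneg ‖g ξ‖)
  have h8 : 0 ≤ t ^ 2 * ‖g (ξ + z) - g ξ‖ ^ 2 := by positivity
  nlinarith [sq_nonneg (‖g (ξ + z) - g ξ‖ - ‖c - 1‖ * ‖g ξ‖)]

/-- The Gagliardo integrand of the time evolution of `g`. -/
noncomputable def evolvedDiff (s : ℝ) (g : ℝ → ℂ) (t : ℝ) (p : ℝ × ℝ) : ℝ :=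
  ‖schrodingerSymbol t (p.1 + p.2) * g (p.1 + p.2) - schrodingerSymbol t p.1 * g p.1‖ ^ 2
    * singWeight s p.2

theorem evolvedDiff_nonneg (s : ℝ) (g : ℝ → ℂ) (t : ℝ) (p : ℝ × ℝ) : 0 ≤ evolvedDiff s g t p :=
  mul_nonneg (sq_nonneg _) (singWeight_nonneg _ _)

theorem measurable_evolvedDiff (s : ℝ) {g : ℝ → ℂ} (hg : Measurable g) :
    Measurable fun q : ℝ × (ℝ × ℝ) => evolvedDiff s g q.1 q.2 := by
  unfold evolvedDiff
  have h1 := measurable_schrodingerSymbol.comp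
    (by fun_prop : Measurable fun q : ℝ × (ℝ × ℝ) => (q.1, q.2.1 + q.2.2))
  have h2 := measurable_schrodingerSymbol.comp
    (by fun_prop : Measurable fun q : ℝ × (ℝ × ℝ) => (q.1, q.2.1))
  simp only [Function.comp_def] at h1 h2
  fun_prop

/-- A majorant that is a product in t and (ξ,z) is what Fubini needs after multiplication by a
rapidly decaying function of t. -/
theorem IsSobolevWeighted.exists_evolvedDiff_le {s : ℝ} (hs₀ : 0 < s) (hs₁ : s < 1) {g : ℝ → ℂ}
    (hg : IsSobolevWeighted s g) :
    ∃ D : ℝ × ℝ → ℝ, Integrable D ∧ ∀ t p, evolvedDiff s g t p ≤ (1 + t ^ 2) * D p := by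
  refine ⟨_, (hg.diff.const_mul 2).add ((hg.integrable_min hs₀ hs₁).const_mul (8 * Real.pi ^ 2)),
    fun t p => ?_⟩
  have h := mul_le_mul_of_nonneg_right (norm_schrodingerSymbol_mul_sub_sq_le g t p.1 p.2)
    (singWeight_nonneg s p.2)
  refine h.trans (le_of_eq ?_)
  simp only [Pi.add_apply]
  ring

theorem IsSobolevWeighted.integrable_evolvedDiff {s : ℝ} (hs₀ : 0 < s) (hs₁ : s < 1) {g : ℝ → ℂ}
    (hg : IsSobolevWeighted s g) (t : ℝ) : Integrable (evolvedDiff s g t) := by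
  obtain ⟨D, hD, hle⟩ := hg.exists_evolvedDiff_le hs₀ hs₁
  refine (hD.const_mul (1 + t ^ 2)).mono'
    ((measurable_evolvedDiff s hg.meas).comp (by fun_prop : Measurable fun p : ℝ × ℝ => (t, p))
      |>.aestronglyMeasurable) (ae_of_all _ fun p => ?_)
  rw [Real.norm_of_nonneg (evolvedDiff_nonneg _ _ _ _)]
  exact hle t p

theorem integrable_norm_sq_of_memLp {u : ℝ → ℂ} (hu : MemLp u 2 volume) :
    Integrable fun x => ‖u x‖ ^ 2 := by
  simpa using hu.integrable_norm_rpow (by norm_num) (by norm_num)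

theorem integrable_weighted_of_memLp {δ : ℝ} {u : ℝ → ℂ}
    (hu : MemLp (fun x : ℝ => ((|x| ^ δ : ℝ) : ℂ) * u x) 2 volume) :
    Integrable fun x => |x| ^ (2 * δ) * ‖u x‖ ^ 2 := by
  refine (integrable_norm_sq_of_memLp hu).congr (ae_of_all _ fun x => ?_)
  simp only
  rw [norm_mul, Complex.norm_real, Real.norm_of_nonneg (by positivity), mul_pow,
    ← Real.rpow_mul_natCast (abs_nonneg x), mul_comm δ]
  norm_num

theorem isSobolevWeighted_fourier {δ : ℝ} (hδ₀ : 0 < δ) (hδ₁ : δ < 1) {f : L2R}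
    (hf : f ∈ SigmaSpace δ) : IsSobolevWeighted δ (𝓕 f : L2R) := by
  have hg : Measurable ((𝓕 f : L2R) : ℝ → ℂ) := (Lp.stronglyMeasurable _).measurable
  refine ⟨hg, integrable_norm_sq_of_memLp (Lp.memLp _), integrable_weighted_of_memLp hf.2, ?_⟩
  · have h1 : Integrable fun x => gagliardoConst δ * (|x| ^ (2 * δ) * ‖f x‖ ^ 2) :=
      (integrable_weighted_of_memLp hf.1).const_mul (gagliardoConst δ)
    refine (lintegral_ofReal_ne_top_iff_integrable (Measurable.aestronglyMeasurable (by fun_prop))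
      (ae_of_all _ fun p => mul_nonneg (sq_nonneg _) (singWeight_nonneg _ _))).1 ?_
    have h2 := gagliardo_fourier hδ₀ hδ₁ f
    rw [gagliardo] at h2
    rw [h2]
    exact h1.lintegral_lt_top.ne

/-- The L² representatives agree almost everywhere in ξ; both projections p.1 and p.1 + p.2 are
quasi-measure-preserving, so they agree inside the double integral. -/
theorem gagliardo_schrodingerSol (δ t : ℝ) (f : L2R) :
    gagliardo δ (𝓕 (schrodingerSol f t) : L2R) =
      ∫⁻ p, ENNReal.ofReal (evolvedDiff δ (𝓕 f : L2R) t p) := by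
  have h := (memLp_schrodingerSymbol_mul t (𝓕 f)).coeFn_toLp
  rw [schrodingerSol, FourierTransform.fourier_fourierInv_eq, gagliardo]
  refine lintegral_congr_ae ?_
  have h1 : ∀ᵐ p : ℝ × ℝ, ((memLp_schrodingerSymbol_mul t (𝓕 f)).toLp _ : L2R) p.1 =
      schrodingerSymbol t p.1 * (𝓕 f : L2R) p.1 :=
    Measure.quasiMeasurePreserving_fst.ae h
  have h2 : ∀ᵐ p : ℝ × ℝ, ((memLp_schrodingerSymbol_mul t (𝓕 f)).toLp _ : L2R) (p.1 + p.2) =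
      schrodingerSymbol t (p.1 + p.2) * (𝓕 f : L2R) (p.1 + p.2) := by
    refine (Measure.QuasiMeasurePreserving.ae (μa := (volume : Measure (ℝ × ℝ))) ?_ h)
    exact Measure.quasiMeasurePreserving_fst.comp
      (measurePreserving_add_prod volume volume).quasiMeasurePreserving
  filter_upwards [h1, h2] with p hp1 hp2
  rw [hp1, hp2, evolvedDiff]

/-- The dispersion functional is a convergent integral, and is a multiple of the Gagliardo energy of
the evolution. -/
theorem dispersion_eq {δ : ℝ} (hδ₀ : 0 < δ) (hδ₁ : δ < 1) {f : L2R} (hf : f ∈ SigmaSpace δ)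
    (t : ℝ) : Integrable (fun x : ℝ => |x| ^ (2 * δ) * ‖schrodingerSol f t x‖ ^ 2) ∧
      dispersion δ f t = (gagliardoConst δ)⁻¹ * ∫ p, evolvedDiff δ (𝓕 f : L2R) t p := by
  have hκ := gagliardoConst_pos hδ₀ hδ₁
  have hE := (isSobolevWeighted_fourier hδ₀ hδ₁ hf).integrable_evolvedDiff hδ₀ hδ₁ t
  have h := gagliardo_fourier hδ₀ hδ₁ (schrodingerSol f t)
  have hu : Measurable (schrodingerSol f t : ℝ → ℂ) := (Lp.stronglyMeasurable _).measurable
  have hm : Measurable fun x : ℝ => |x| ^ (2 * δ) * ‖schrodingerSol f t x‖ ^ 2 := by fun_prop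
  rw [gagliardo_schrodingerSol, ← ofReal_integral_eq_lintegral_ofReal hE
    (ae_of_all _ fun p => evolvedDiff_nonneg _ _ _ _)] at h
  have hi : Integrable fun x : ℝ =>
      gagliardoConst δ * (|x| ^ (2 * δ) * ‖schrodingerSol f t x‖ ^ 2) := by
    refine (lintegral_ofReal_ne_top_iff_integrable (hm.const_mul _).aestronglyMeasurable
      (ae_of_all _ fun p => by positivity)).1 ?_
    rw [← h]
    exact ENNReal.ofReal_ne_top
  have hi' : Integrable fun x : ℝ => |x| ^ (2 * δ) * ‖schrodingerSol f t x‖ ^ 2 := by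
    simpa [hκ.ne'] using hi.const_mul (gagliardoConst δ)⁻¹
  refine ⟨hi', ?_⟩
  rw [← ofReal_integral_eq_lintegral_ofReal hi (ae_of_all _ fun p => by positivity),
    ENNReal.ofReal_eq_ofReal_iff (integral_nonneg fun p => evolvedDiff_nonneg _ _ _ _)
      (integral_nonneg fun p => by positivity), integral_const_mul] at h
  rw [h, dispersion, inv_mul_cancel_left₀ hκ.ne']

/-! ### Test functions, Fourier inversion in time and the formula for the pairing. -/

/-- Even smooth compactly supported functions equal to `1` near `0`. -/
structure IsEvenBump (φ : ℝ → ℝ) : Prop where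
  smooth : ContDiff ℝ ∞ φ
  compact : HasCompactSupport φ
  even : ∀ t, φ (-t) = φ t
  eq_one : ∀ᶠ t in 𝓝 (0 : ℝ), φ t = 1

theorem IsSymmCutoff.hasCompactSupport {ζ : ℝ → ℝ} (hζ : IsSymmCutoff ζ) : HasCompactSupport ζ :=
  HasCompactSupport.of_support_subset_isCompact (isCompact_Icc (a := -1) (b := 1))
    ((subset_tsupport ζ).trans (hζ.supp.trans Ioo_subset_Icc_self))

theorem IsSymmCutoff.isEvenBump_rescale {ζ : ℝ → ℝ} (hζ : IsSymmCutoff ζ) {ε : ℝ} (hε : 0 < ε) :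
    IsEvenBump (rescale ζ ε) where
  smooth := hζ.smooth.comp (contDiff_id.div_const ε)
  compact := by
    have := hζ.hasCompactSupport.comp_smul (c := ε⁻¹) (inv_ne_zero hε.ne')
    refine (congrArg HasCompactSupport (funext fun t => ?_)).mp this
    rw [rescale, smul_eq_mul, div_eq_inv_mul]
  even t := by rw [rescale, neg_div, hζ.symm]; rfl
  eq_one := by
    have h : Tendsto (fun t : ℝ => t / ε) (𝓝 0) (𝓝 0) := by
      have : Continuous fun t : ℝ => t / ε := by fun_prop
      simpa using this.tendsto 0
    exact h.eventually hζ.eq_one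

theorem exists_abs_one_sub_le {φ : ℝ → ℝ} (h1 : ∀ᶠ t in 𝓝 (0 : ℝ), φ t = 1) {M : ℝ}
    (hM : ∀ t, |φ t| ≤ M) : ∃ C, 0 ≤ C ∧ ∀ t, |1 - φ t| ≤ C * min 1 |t| ^ 2 := by
  obtain ⟨r, hr, h⟩ := Metric.eventually_nhds_iff.1 h1
  have hM0 : 0 ≤ M := (abs_nonneg _).trans (hM 0)
  have hr' : 0 < min 1 r := lt_min one_pos hr
  refine ⟨(1 + M) / min 1 r ^ 2, by positivity, fun t => ?_⟩
  rcases lt_or_ge |t| r with ht | ht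
  · rw [h (by simpa using ht), sub_self, abs_zero]
    positivity
  · have h2 : |1 - φ t| ≤ 1 + M := (abs_sub _ _).trans (by rw [abs_one]; linarith [hM t])
    have h3 : min 1 r ^ 2 ≤ min 1 |t| ^ 2 :=
      pow_le_pow_left₀ hr'.le (min_le_min_left 1 ht) 2
    rw [div_mul_eq_mul_div, le_div_iff₀ (by positivity)]
    exact mul_le_mul h2 h3 (by positivity) (by positivity)

namespace IsEvenBump

variable {φ : ℝ → ℝ}

theorem exists_abs_le (hφ : IsEvenBump φ) : ∃ M, ∀ t, |φ t| ≤ M :=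
  hφ.compact.exists_bound_of_continuous hφ.smooth.continuous

theorem exists_abs_one_sub_le (hφ : IsEvenBump φ) :
    ∃ C, 0 ≤ C ∧ ∀ t, |1 - φ t| ≤ C * min 1 |t| ^ 2 :=
  let ⟨_, hM⟩ := hφ.exists_abs_le
  _root_.exists_abs_one_sub_le hφ.eq_one hM

theorem exists_schwartzMap (hφ : IsEvenBump φ) :
    ∃ Φ : SchwartzMap ℝ ℂ, (Φ : ℝ → ℂ) = fun t => (φ t : ℂ) := by
  have hc : HasCompactSupport (fun x => (φ x : ℂ)) := hφ.compact.comp_left Complex.ofReal_zero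
  have hs : ContDiff ℝ ∞ (fun x => (φ x : ℂ)) := Complex.ofRealCLM.contDiff.comp hφ.smooth
  exact ⟨hc.toSchwartzMap hs, rfl⟩

theorem continuous_fourier (hφ : IsEvenBump φ) : Continuous (𝓕 fun t => (φ t : ℂ)) := by
  obtain ⟨Φ, hΦ⟩ := hφ.exists_schwartzMap
  rw [← hΦ, ← SchwartzMap.fourier_coe]
  exact (𝓕 Φ).continuous

theorem integrable_fourier (hφ : IsEvenBump φ) : Integrable (𝓕 fun t => (φ t : ℂ)) := by
  obtain ⟨Φ, hΦ⟩ := hφ.exists_schwartzMap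
  rw [← hΦ, ← SchwartzMap.fourier_coe]
  exact (𝓕 Φ).integrable

theorem integrable_sq_mul_fourier (hφ : IsEvenBump φ) :
    Integrable fun t : ℝ => (1 + t ^ 2) * ‖(𝓕 fun t => (φ t : ℂ)) t‖ := by
  obtain ⟨Φ, hΦ⟩ := hφ.exists_schwartzMap
  rw [← hΦ, ← SchwartzMap.fourier_coe]
  have h := (𝓕 Φ).integrable.norm.add ((𝓕 Φ).integrable_pow_mul volume 2)
  refine h.congr (ae_of_all _ fun t => ?_)
  simp only [Pi.add_apply, Real.norm_eq_abs, sq_abs]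
  ring

theorem integral_fourierChar_mul_fourier (hφ : IsEvenBump φ) (σ : ℝ) :
    ∫ t : ℝ, (Real.fourierChar (t * σ) : ℂ) * (𝓕 fun t => (φ t : ℂ)) t = φ σ := by
  obtain ⟨Φ, hΦ⟩ := hφ.exists_schwartzMap
  have h := congrArg (fun F : SchwartzMap ℝ ℂ => F σ) 
    (FourierTransform.fourierInv_fourier_eq Φ : 𝓕⁻ (𝓕 Φ) = Φ)
  simp only [SchwartzMap.fourierInv_coe, SchwartzMap.fourier_coe, hΦ] at h
  rw [← h, Real.fourierInv_eq]
  congr 1 with t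
  rw [Circle.smul_def, smul_eq_mul]
  simp [mul_comm]

end IsEvenBump

theorem norm_sub_sq_complex (a b : ℂ) :
    ((‖a - b‖ ^ 2 : ℝ) : ℂ) = ((‖a‖ ^ 2 + ‖b‖ ^ 2 : ℝ) : ℂ) -
      (a * (starRingEnd ℂ) b + (starRingEnd ℂ) a * b) := by
  push_cast
  rw [← Complex.mul_conj', ← Complex.mul_conj', ← Complex.mul_conj', map_sub]
  ring

/-- The Gagliardo integrand of the pairing with a test function `φ`. -/
noncomputable def pairedDiff (s : ℝ) (g : ℝ → ℂ) (φ : ℝ → ℝ) (p : ℝ × ℝ) : ℝ :=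
  (‖g (p.1 + p.2) - g p.1‖ ^ 2 * φ (halfSqDiff p.1 p.2)
    + (‖g (p.1 + p.2)‖ ^ 2 + ‖g p.1‖ ^ 2) * (1 - φ (halfSqDiff p.1 p.2))) * singWeight s p.2

/-- In the expanded square the time-independent terms integrate to φ(0) = 1 and the two cross terms
to φ(±σ), which coincide because φ is even. Writing the cross terms back as a difference of squares
gives `pairedDiff`. -/
theorem integral_evolvedDiff_mul_fourier (s : ℝ) (g : ℝ → ℂ) {φ : ℝ → ℝ} (hφ : IsEvenBump φ)
    (p : ℝ × ℝ) :
    ∫ t, (evolvedDiff s g t p : ℂ) * (𝓕 fun t => (φ t : ℂ)) t = (pairedDiff s g φ p : ℂ) := by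
  obtain ⟨ξ, z⟩ := p
  set σ := halfSqDiff ξ z with hσ
  set F := 𝓕 fun t => (φ t : ℂ) with hF
  set a := g (ξ + z)
  set b := g ξ
  have hint (σ : ℝ) : Integrable fun t : ℝ => (Real.fourierChar (t * σ) : ℂ) * F t := by
    refine hφ.integrable_fourier.norm.mono'
      ((Continuous.mul (by fun_prop) hφ.continuous_fourier).aestronglyMeasurable)
      (ae_of_all _ fun t => ?_)
    rw [norm_mul, Circle.norm_coe, one_mul]
  have h1 : ∀ t : ℝ, (evolvedDiff s g t (ξ, z) : ℂ) * F t =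
      (singWeight s z : ℂ) * (((‖a‖ ^ 2 + ‖b‖ ^ 2 : ℝ) : ℂ)
        * ((Real.fourierChar (t * 0) : ℂ) * F t)
        - (a * (starRingEnd ℂ) b * ((Real.fourierChar (t * -σ) : ℂ) * F t)
          + (starRingEnd ℂ) a * b * ((Real.fourierChar (t * σ) : ℂ) * F t))) := fun t => by
    have h2 : (starRingEnd ℂ) (Real.fourierChar (t * -σ) : ℂ) = (Real.fourierChar (t * σ) : ℂ) := by
      rw [← Circle.coe_inv_eq_conj, ← AddChar.map_neg_eq_inv]
      congr 2
      ring
    have h3 := norm_sub_sq_complex ((Real.fourierChar (t * -σ) : ℂ) * a) b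
    rw [norm_mul, Circle.norm_coe, one_mul, map_mul (starRingEnd ℂ), h2] at h3
    rw [evolvedDiff, norm_schrodingerSymbol_mul_sub, ← mul_neg, ← hσ, Complex.ofReal_mul, h3]
    simp only [mul_zero, AddChar.map_zero_eq_one, Circle.coe_one, one_mul]
    ring
  simp_rw [h1]
  have h0 : φ 0 = 1 := hφ.eq_one.self_of_nhds
  have e1 := (hint 0).const_mul ((‖a‖ ^ 2 + ‖b‖ ^ 2 : ℝ) : ℂ)
  have e2 := (hint (-σ)).const_mul (a * (starRingEnd ℂ) b)
  have e3 := (hint σ).const_mul ((starRingEnd ℂ) a * b)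
  have e4 : Integrable fun t => a * (starRingEnd ℂ) b * ((Real.fourierChar (t * -σ) : ℂ) * F t)
      + (starRingEnd ℂ) a * b * ((Real.fourierChar (t * σ) : ℂ) * F t) := e2.add e3
  rw [integral_const_mul, integral_sub e1 e4, integral_add e2 e3, integral_const_mul,
    integral_const_mul, integral_const_mul, hφ.integral_fourierChar_mul_fourier,
    hφ.integral_fourierChar_mul_fourier, hφ.integral_fourierChar_mul_fourier, hφ.even, h0,
    pairedDiff]
  have h4 := norm_sub_sq_complex a b
  simp only [Complex.ofReal_mul, Complex.ofReal_add, Complex.ofReal_sub] at h4 ⊢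
  rw [h4]
  push_cast
  ring

theorem IsSobolevWeighted.integrable_evolvedDiff_mul_fourier {s : ℝ} (hs₀ : 0 < s) (hs₁ : s < 1)
    {g : ℝ → ℂ} (hg : IsSobolevWeighted s g) {φ : ℝ → ℝ} (hφ : IsEvenBump φ) :
    Integrable (fun q : ℝ × (ℝ × ℝ) =>
      (evolvedDiff s g q.1 q.2 : ℂ) * (𝓕 fun t => (φ t : ℂ)) q.1) (volume.prod volume) := by
  obtain ⟨D, hD, hle⟩ := hg.exists_evolvedDiff_le hs₀ hs₁
  have hm := measurable_evolvedDiff s hg.meas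
  have hF := hφ.continuous_fourier.measurable
  refine (hφ.integrable_sq_mul_fourier.mul_prod hD).mono'
    (Measurable.aestronglyMeasurable (by fun_prop)) (ae_of_all _ fun q => ?_)
  rw [norm_mul, Complex.norm_real, Real.norm_of_nonneg (evolvedDiff_nonneg _ _ _ _)]
  calc _ ≤ (1 + q.1 ^ 2) * D q.2 * ‖(𝓕 fun t => (φ t : ℂ)) q.1‖ :=
        mul_le_mul_of_nonneg_right (hle _ _) (norm_nonneg _)
    _ = _ := by ring

theorem dispersion_mul_fourier_eq {δ : ℝ} (hδ₀ : 0 < δ) (hδ₁ : δ < 1) {f : L2R}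
    (hf : f ∈ SigmaSpace δ) (φ : ℝ → ℝ) (t : ℝ) :
    (dispersion δ f t : ℂ) * (𝓕 fun t => (φ t : ℂ)) t = (gagliardoConst δ : ℂ)⁻¹ *
      ∫ p, (evolvedDiff δ (𝓕 f : L2R) t p : ℂ) * (𝓕 fun t => (φ t : ℂ)) t := by
  rw [integral_mul_const, integral_complex_ofReal, (dispersion_eq hδ₀ hδ₁ hf t).2]
  push_cast
  ring

theorem integrable_dispersion_mul_fourier {δ : ℝ} (hδ₀ : 0 < δ) (hδ₁ : δ < 1) {f : L2R}
    (hf : f ∈ SigmaSpace δ) {φ : ℝ → ℝ} (hφ : IsEvenBump φ) :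
    Integrable fun t => (dispersion δ f t : ℂ) * (𝓕 fun t => (φ t : ℂ)) t := by
  simp_rw [dispersion_mul_fourier_eq hδ₀ hδ₁ hf]
  exact ((isSobolevWeighted_fourier hδ₀ hδ₁ hf).integrable_evolvedDiff_mul_fourier hδ₀ hδ₁
    hφ).integral_prod_left.const_mul _

theorem IsSobolevWeighted.integrable_pairedDiff {s : ℝ} (hs₀ : 0 < s) (hs₁ : s < 1)
    {g : ℝ → ℂ} (hg : IsSobolevWeighted s g) {φ : ℝ → ℝ} (hφ : IsEvenBump φ) :
    Integrable (pairedDiff s g φ) := by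
  have h := (hg.integrable_evolvedDiff_mul_fourier hs₀ hs₁ hφ).integral_prod_right
  simp only [integral_evolvedDiff_mul_fourier s g hφ] at h
  simpa using h.re

theorem fourierPairing_dispersion {δ : ℝ} (hδ₀ : 0 < δ) (hδ₁ : δ < 1) {f : L2R}
    (hf : f ∈ SigmaSpace δ) {φ : ℝ → ℝ} (hφ : IsEvenBump φ) :
    fourierPairing (dispersion δ f) φ =
      (((gagliardoConst δ)⁻¹ * ∫ p, pairedDiff δ (𝓕 f : L2R) φ p : ℝ) : ℂ) := by
  rw [fourierPairing]
  simp_rw [dispersion_mul_fourier_eq hδ₀ hδ₁ hf]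
  rw [integral_const_mul, integral_integral_swap
    ((isSobolevWeighted_fourier hδ₀ hδ₁ hf).integrable_evolvedDiff_mul_fourier hδ₀ hδ₁ hφ)]
  simp_rw [integral_evolvedDiff_mul_fourier δ _ hφ]
  rw [integral_complex_ofReal]
  push_cast
  rfl

/-! ### Reduction to a one-variable kernel, and its scaling. -/

theorem IsSobolevWeighted.integrable_norm_sq_mul_one_sub {s : ℝ} (hs₀ : 0 < s) (hs₁ : s < 1)
    {g : ℝ → ℂ} (hg : IsSobolevWeighted s g) {φ : ℝ → ℝ} (hφ : IsEvenBump φ) :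
    Integrable fun p : ℝ × ℝ =>
      ‖g p.1‖ ^ 2 * ((1 - φ (halfSqDiff p.1 p.2)) * singWeight s p.2) := by
  obtain ⟨C, hC, hle⟩ := hφ.exists_abs_one_sub_le
  have hgm := hg.meas
  have hφm := hφ.smooth.continuous.measurable
  refine ((hg.integrable_min hs₀ hs₁).const_mul C).mono' (Measurable.aestronglyMeasurable
    (by unfold halfSqDiff; fun_prop)) (ae_of_all _ fun p => ?_)
  rw [norm_mul, norm_mul, Real.norm_of_nonneg (sq_nonneg _),
    Real.norm_of_nonneg (singWeight_nonneg _ _), Real.norm_eq_abs]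
  have := singWeight_nonneg s p.2
  calc _ ≤ ‖g p.1‖ ^ 2 * (C * min 1 |halfSqDiff p.1 p.2| ^ 2 * singWeight s p.2) := by
        gcongr; exact hle _
    _ = _ := by ring

/-- The kernel `∫ (1 - φ(ξz + z²/2)) |z|^(-1-2s) dz`. -/
noncomputable def cutoffKernel (s : ℝ) (φ : ℝ → ℝ) (ξ : ℝ) : ℝ :=
  ∫ z, (1 - φ (halfSqDiff ξ z)) * singWeight s z

/-- The involution (ξ,z) ↦ (ξ+z,-z) preserves measure and weight and reverses the sign of the phase.
As φ is even, |g(ξ+z)|² and |g(ξ)|² contribute equally, whence the factor 2. -/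
theorem IsSobolevWeighted.integral_pairedDiff {s : ℝ} (hs₀ : 0 < s) (hs₁ : s < 1)
    {g : ℝ → ℂ} (hg : IsSobolevWeighted s g) {φ : ℝ → ℝ} (hφ : IsEvenBump φ) :
    ∫ p, pairedDiff s g φ p =
      (∫ p : ℝ × ℝ, ‖g (p.1 + p.2) - g p.1‖ ^ 2 * singWeight s p.2 * φ (halfSqDiff p.1 p.2))
        + 2 * ∫ ξ, ‖g ξ‖ ^ 2 * cutoffKernel s φ ξ := by
  set q : ℝ × ℝ → ℝ := fun p => ‖g p.1‖ ^ 2 * ((1 - φ (halfSqDiff p.1 p.2)) * singWeight s p.2)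
    with hq
  have hqi : Integrable q := hg.integrable_norm_sq_mul_one_sub hs₀ hs₁ hφ
  let T : ℝ × ℝ ≃ᵐ ℝ × ℝ :=
    { toFun := fun p => (p.1 + p.2, -p.2)
      invFun := fun p => (p.1 + p.2, -p.2)
      left_inv := fun p => by simp
      right_inv := fun p => by simp
      measurable_toFun := by
        change Measurable fun p : ℝ × ℝ => (p.1 + p.2, -p.2)
        fun_prop
      measurable_invFun := by
        change Measurable fun p : ℝ × ℝ => (p.1 + p.2, -p.2)
        fun_prop }
  have hT : MeasurePreserving T (volume : Measure (ℝ × ℝ)) volume :=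
    ((MeasurePreserving.id (volume : Measure ℝ)).prod
      (Measure.measurePreserving_neg (volume : Measure ℝ))).comp
      (measurePreserving_add_prod (volume : Measure ℝ) (volume : Measure ℝ))
  have hqT : ∀ p, q (T p) =
      ‖g (p.1 + p.2)‖ ^ 2 * ((1 - φ (halfSqDiff p.1 p.2)) * singWeight s p.2) := fun p => by
    have : halfSqDiff (p.1 + p.2) (-p.2) = -halfSqDiff p.1 p.2 := by unfold halfSqDiff; ring
    change ‖g (p.1 + p.2)‖ ^ 2 * ((1 - φ (halfSqDiff (p.1 + p.2) (-p.2))) * singWeight s (-p.2)) = _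
    rw [this, hφ.even, singWeight_neg]
  have hqTi : Integrable fun p => q (T p) := (hT.integrable_comp_emb T.measurableEmbedding).2 hqi
  have hsplit : pairedDiff s g φ = fun p =>
      ‖g (p.1 + p.2) - g p.1‖ ^ 2 * singWeight s p.2 * φ (halfSqDiff p.1 p.2)
        + (q (T p) + q p) := by
    funext p
    rw [hqT, pairedDiff]
    ring
  have h1 : Integrable fun p : ℝ × ℝ =>
      ‖g (p.1 + p.2) - g p.1‖ ^ 2 * singWeight s p.2 * φ (halfSqDiff p.1 p.2) := by
    have := (hg.integrable_pairedDiff hs₀ hs₁ hφ).sub (hqTi.add hqi)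
    refine this.congr (ae_of_all _ fun p => ?_)
    simp [hsplit]
  have h2 : Integrable fun p => q (T p) + q p := hqTi.add hqi
  simp only [hsplit]
  rw [integral_add h1 h2, integral_add hqTi hqi,
    hT.integral_comp T.measurableEmbedding, ← two_mul, Measure.volume_eq_prod,
    integral_prod q hqi]
  simp_rw [hq, integral_const_mul]
  rfl

theorem IsSymmCutoff.isEvenBump {ζ : ℝ → ℝ} (hζ : IsSymmCutoff ζ) : IsEvenBump ζ where
  smooth := hζ.smooth
  compact := hζ.hasCompactSupport
  even := hζ.symm
  eq_one := hζ.eq_one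

theorem IsSymmCutoff.eq_zero {ζ : ℝ → ℝ} (hζ : IsSymmCutoff ζ) {t : ℝ} (ht : 1 ≤ |t|) :
    ζ t = 0 := by
  by_contra h
  have := hζ.supp (subset_tsupport ζ h)
  exact absurd (abs_lt.2 this) ht.not_gt

/-- The phase is homogeneous of degree 2 in (ξ,z) jointly, so dividing it by ε amounts to dividing
both variables by √ε. -/
theorem cutoffKernel_rescale (s : ℝ) (ζ : ℝ → ℝ) {ε : ℝ} (hε : 0 < ε) (ξ : ℝ) :
    cutoffKernel s (rescale ζ ε) ξ = ε ^ (-s) * cutoffKernel s ζ (ξ / Real.sqrt ε) := by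
  have hs : 0 < Real.sqrt ε := Real.sqrt_pos.2 hε
  have h := integral_comp_mul_singWeight s
    (fun y => 1 - ζ (halfSqDiff (ξ / Real.sqrt ε) y)) (inv_ne_zero hs.ne')
  have h1 : |(Real.sqrt ε)⁻¹| ^ (2 * s) = ε ^ (-s) := by
    rw [abs_of_pos (inv_pos.2 hs), Real.inv_rpow hs.le, Real.sqrt_eq_rpow, ← Real.rpow_mul hε.le,
      ← Real.rpow_neg hε.le]
    ring_nf
  rw [h1] at h
  have h2 (z : ℝ) : halfSqDiff ξ z / ε =
      halfSqDiff (ξ / Real.sqrt ε) ((Real.sqrt ε)⁻¹ * z) := by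
    have h3 : Real.sqrt ε ^ 2 = ε := Real.sq_sqrt hε.le
    rw [halfSqDiff, halfSqDiff]
    field_simp
    rw [h3]
  rw [cutoffKernel, cutoffKernel, ← h]
  simp only [rescale, h2]

/-! ### Asymptotics of the kernel at infinity. -/

/-- The leading coefficient `∫ (1 - φ(w)) |w|^(-1-2s) dw` of the cutoff kernel. -/
noncomputable def kernelConst (s : ℝ) (φ : ℝ → ℝ) : ℝ := ∫ w, (1 - φ w) * singWeight s w

/-- The cutoff kernel minus its leading term at infinity. -/
noncomputable def kernelRemainder (s : ℝ) (φ : ℝ → ℝ) (x : ℝ) : ℝ :=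
  cutoffKernel s φ x - kernelConst s φ * |x| ^ (2 * s)

namespace IsEvenBump

variable {φ : ℝ → ℝ}

theorem measurable_cutoffKernel (hφ : IsEvenBump φ) (s : ℝ) : Measurable (cutoffKernel s φ) := by
  have hφm := hφ.smooth.continuous.measurable
  have h : Measurable fun p : ℝ × ℝ => (1 - φ (halfSqDiff p.1 p.2)) * singWeight s p.2 := by
    unfold halfSqDiff; fun_prop
  exact h.stronglyMeasurable.integral_prod_right.measurable

theorem measurable_kernelRemainder (hφ : IsEvenBump φ) (s : ℝ) :
    Measurable (kernelRemainder s φ) := by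
  have := hφ.measurable_cutoffKernel s
  unfold kernelRemainder
  fun_prop

theorem integrable_one_sub_mul_singWeight (hφ : IsEvenBump φ) {s : ℝ} (hs₀ : 0 < s) (hs₁ : s < 1) :
    Integrable fun w => (1 - φ w) * singWeight s w := by
  obtain ⟨C, hC, hle⟩ := hφ.exists_abs_one_sub_le
  have hφm := hφ.smooth.continuous.measurable
  refine ((integrable_min_sq_mul_singWeight hs₀ hs₁).const_mul C).mono'
    (Measurable.aestronglyMeasurable (by fun_prop)) (ae_of_all _ fun w => ?_)
  rw [norm_mul, Real.norm_of_nonneg (singWeight_nonneg _ _), ← mul_assoc]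
  exact mul_le_mul_of_nonneg_right (hle w) (singWeight_nonneg _ _)

theorem integrable_one_sub_halfSqDiff_mul_singWeight (hφ : IsEvenBump φ) {s : ℝ} (hs₀ : 0 < s)
    (hs₁ : s < 1) (x : ℝ) : Integrable fun z => (1 - φ (halfSqDiff x z)) * singWeight s z := by
  obtain ⟨C, hC, hle⟩ := hφ.exists_abs_one_sub_le
  have hφm := hφ.smooth.continuous.measurable
  refine ((integrable_min_halfSqDiff hs₀ hs₁ x).const_mul C).mono'
    (Measurable.aestronglyMeasurable (by unfold halfSqDiff; fun_prop)) (ae_of_all _ fun w => ?_)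
  rw [norm_mul, Real.norm_of_nonneg (singWeight_nonneg _ _), ← mul_assoc]
  exact mul_le_mul_of_nonneg_right (hle _) (singWeight_nonneg _ _)

theorem exists_abs_cutoffKernel_le (hφ : IsEvenBump φ) {s : ℝ} (hs₀ : 0 < s) (hs₁ : s < 1) :
    ∃ C, 0 ≤ C ∧ ∀ x, |cutoffKernel s φ x| ≤ C * (1 + |x| ^ (2 * s)) := by
  obtain ⟨C, hC, hle⟩ := hφ.exists_abs_one_sub_le
  obtain ⟨C', hC', hle'⟩ := exists_integral_min_halfSqDiff_le hs₀ hs₁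
  refine ⟨C * C', by positivity, fun x => ?_⟩
  calc |cutoffKernel s φ x| ≤ ∫ z, C * (min 1 |halfSqDiff x z| ^ 2 * singWeight s z) := by
        rw [cutoffKernel, ← Real.norm_eq_abs]
        refine norm_integral_le_of_norm_le ((integrable_min_halfSqDiff hs₀ hs₁ x).const_mul C)
          (ae_of_all _ fun w => ?_)
        rw [norm_mul, Real.norm_of_nonneg (singWeight_nonneg _ _), ← mul_assoc]
        exact mul_le_mul_of_nonneg_right (hle _) (singWeight_nonneg _ _)
    _ ≤ _ := by
        rw [integral_const_mul, mul_assoc]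
        exact mul_le_mul_of_nonneg_left (hle' x) hC

/-- The derivative of t ↦ φ(w+t) + φ(w-t) is at most 2L|t|, with L a Lipschitz constant of φ'; the
mean value inequality supplies the second factor |h|. -/
theorem exists_abs_second_difference_le (hφ : IsEvenBump φ) :
    ∃ M, 0 ≤ M ∧ ∀ w h, |2 * φ w - φ (w + h) - φ (w - h)| ≤ M * h ^ 2 := by
  have hd : Differentiable ℝ φ := hφ.smooth.differentiable (by simp)
  have h1 : ContDiff ℝ ∞ (deriv φ) := (contDiff_infty_iff_deriv.1 hφ.smooth).2
  obtain ⟨L, hL⟩ := h1.lipschitzWith_of_hasCompactSupport hφ.compact.deriv (by simp)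
  refine ⟨2 * L, by positivity, fun w h => ?_⟩
  have hf (t : ℝ) : HasDerivAt (fun t => φ (w + t) + φ (w - t))
      (deriv φ (w + t) - deriv φ (w - t)) t := by
    have a1 := (hd (w + t)).hasDerivAt.comp_const_add w t
    have a2 := (hd (w - t)).hasDerivAt.comp_const_sub w t
    exact (a1.add a2).congr_deriv (by ring)
  have hb : ∀ t ∈ uIcc 0 h, ‖deriv φ (w + t) - deriv φ (w - t)‖ ≤ 2 * L * |h| := fun t ht => by
    have a := hL.dist_le_mul (w + t) (w - t)
    rw [dist_eq_norm, dist_eq_norm] at a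
    refine a.trans ?_
    have : w + t - (w - t) = 2 * t := by ring
    rw [this, norm_mul, Real.norm_eq_abs, Real.norm_eq_abs, abs_two]
    have ht' : |t| ≤ |h| := by simpa using abs_sub_left_of_mem_uIcc ht
    have hL0 : (0 : ℝ) ≤ L := L.2
    nlinarith
  have key := (convex_uIcc 0 h).norm_image_sub_le_of_norm_hasDerivWithin_le
    (fun t _ => (hf t).hasDerivWithinAt) hb left_mem_uIcc right_mem_uIcc
  simp only [add_zero, sub_zero, Real.norm_eq_abs] at key
  rw [← abs_neg]
  calc _ = |φ (w + h) + φ (w - h) - (φ w + φ w)| := by ring_nf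
    _ ≤ 2 * L * |h| * |h| := key
    _ = _ := by rw [mul_assoc, abs_mul_abs_self, sq]

end IsEvenBump

theorem singWeight_le {s r w : ℝ} (hs : 0 < s) (hr : 0 < r) (hw : r ≤ |w|) :
    singWeight s w ≤ r ^ (-1 - 2 * s) :=
  Real.rpow_le_rpow_of_nonpos hr hw (by linarith)

/-- The maps w ± σw² vanish at 0 and at ∓1/σ. Around 0 the second difference gives σ²; around ∓1/σ
there is no cancellation, but the weight itself is O(σ^(1+2s)). -/
theorem IsSymmCutoff.exists_symmetrized_difference_le {ζ : ℝ → ℝ} (hζ : IsSymmCutoff ζ) {s : ℝ}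
    (hs : 0 < s) : ∃ C, 0 ≤ C ∧ ∀ σ : ℝ, 0 < σ → σ ≤ 1 / 8 → ∀ w,
      |2 * ζ w - ζ (w + σ * w ^ 2) - ζ (w - σ * w ^ 2)| * singWeight s w ≤
        C * (σ ^ 2 * (Icc (-2) 2).indicator 1 w
          + σ ^ (1 + 2 * s) * ((Icc (-1 / σ - 2) (-1 / σ + 2)).indicator 1 w
            + (Icc (1 / σ - 2) (1 / σ + 2)).indicator 1 w)) := by
  obtain ⟨M, hM0, hM⟩ := hζ.isEvenBump.exists_abs_second_difference_le
  obtain ⟨N, hN⟩ := hζ.isEvenBump.exists_abs_le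
  have hN0 : 0 ≤ N := (abs_nonneg _).trans (hN 0)
  obtain ⟨r, hr, hr1⟩ := Metric.eventually_nhds_iff.1 hζ.eq_one
  have hone (t : ℝ) (ht : |t| < r) : ζ t = 1 := hr1 (by simpa using ht)
  -- On r/2 ≤ |w| ≤ 2 one has (σw²)² ≤ 16σ², and the weight is at most (r/2)^(-1-2s).
  set C₁ := M * 16 * (r / 2) ^ (-1 - 2 * s) with hC₁
  set C₂ := N * 2 ^ (1 + 2 * s) with hC₂
  have hC₁0 : 0 ≤ C₁ := by positivity
  have hC₂0 : 0 ≤ C₂ := by positivity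
  refine ⟨C₁ + C₂, by positivity, fun σ hσ hσ8 w => ?_⟩
  have hi (S : Set ℝ) : 0 ≤ S.indicator (1 : ℝ → ℝ) w := indicator_nonneg (fun _ _ => zero_le_one) w
  have hW := singWeight_nonneg s w
  have hA : 0 ≤ σ ^ 2 * (Icc (-2) 2).indicator (1 : ℝ → ℝ) w := mul_nonneg (sq_nonneg _) (hi _)
  have hB : 0 ≤ σ ^ (1 + 2 * s) * ((Icc (-1 / σ - 2) (-1 / σ + 2)).indicator (1 : ℝ → ℝ) w
      + (Icc (1 / σ - 2) (1 / σ + 2)).indicator 1 w) :=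
    mul_nonneg (by positivity) (add_nonneg (hi _) (hi _))
  rcases le_or_gt (σ * |w|) (1 / 2) with hw | hw
  · suffices h : |2 * ζ w - ζ (w + σ * w ^ 2) - ζ (w - σ * w ^ 2)| * singWeight s w ≤
        C₁ * (σ ^ 2 * (Icc (-2) 2).indicator 1 w) by
      refine h.trans ?_
      nlinarith [mul_nonneg hC₁0 hB, mul_nonneg hC₂0 hA, mul_nonneg hC₂0 hB]
    have hq : σ * w ^ 2 ≤ |w| / 2 := by
      rw [← sq_abs]; nlinarith [abs_nonneg w]
    have hq0 : 0 ≤ σ * w ^ 2 := by positivity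
    have b1 : |w + σ * w ^ 2| ≤ 3 / 2 * |w| := (abs_add_le _ _).trans (by
      rw [abs_of_nonneg hq0]; linarith)
    have b2 : |w - σ * w ^ 2| ≤ 3 / 2 * |w| := (abs_sub _ _).trans (by
      rw [abs_of_nonneg hq0]; linarith)
    have b3 : |w| / 2 ≤ |w + σ * w ^ 2| := by
      have := abs_sub_abs_le_abs_sub w (-(σ * w ^ 2))
      rw [abs_neg, abs_of_nonneg hq0, sub_neg_eq_add] at this
      linarith
    have b4 : |w| / 2 ≤ |w - σ * w ^ 2| := by
      have := abs_sub_abs_le_abs_sub w (σ * w ^ 2)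
      rw [abs_of_nonneg hq0] at this
      linarith
    -- Here w ± σw² has modulus between |w|/2 and 3|w|/2. For |w| < r/2 all three values of ζ equal
    -- 1, for |w| > 2 all three vanish, so the singularity of the weight is never met.
    rcases lt_or_ge |w| (r / 2) with h1 | h1
    · rw [hone w (by linarith), hone _ (b1.trans_lt (by linarith)),
        hone _ (b2.trans_lt (by linarith))]
      norm_num
      exact mul_nonneg hC₁0 hA
    · rcases le_or_gt |w| 2 with h2 | h2
      · rw [indicator_of_mem (show w ∈ Icc (-2 : ℝ) 2 from abs_le.1 h2), Pi.one_apply, mul_one]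
        have h3 : (σ * w ^ 2) ^ 2 ≤ 16 * σ ^ 2 := by
          have : w ^ 2 ≤ 4 := by rw [← sq_abs]; nlinarith [abs_nonneg w]
          rw [mul_pow]
          nlinarith [sq_nonneg w, sq_nonneg σ, mul_self_le_mul_self (sq_nonneg w) this]
        calc _ ≤ M * (16 * σ ^ 2) * (r / 2) ^ (-1 - 2 * s) :=
              mul_le_mul ((hM w _).trans (mul_le_mul_of_nonneg_left h3 hM0))
                (singWeight_le hs (by linarith) h1) hW (by positivity)
          _ = _ := by rw [hC₁]; ring
      · rw [hζ.eq_zero (by linarith : 1 ≤ |w|), hζ.eq_zero (by linarith : 1 ≤ |w + σ * w ^ 2|),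
          hζ.eq_zero (by linarith : 1 ≤ |w - σ * w ^ 2|)]
        norm_num
        exact mul_nonneg hC₁0 hA
  · suffices h : |2 * ζ w - ζ (w + σ * w ^ 2) - ζ (w - σ * w ^ 2)| * singWeight s w ≤
        C₂ * (σ ^ (1 + 2 * s) * ((Icc (-1 / σ - 2) (-1 / σ + 2)).indicator 1 w
          + (Icc (1 / σ - 2) (1 / σ + 2)).indicator 1 w)) by
      refine h.trans ?_
      nlinarith [mul_nonneg hC₁0 hB, mul_nonneg hC₂0 hA, mul_nonneg hC₁0 hA]
    have hw' : 1 / (2 * σ) ≤ |w| := by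
      rw [div_le_iff₀ (by positivity)]; linarith
    have hw1 : 1 ≤ |w| := by nlinarith
    have hwpos : 0 < |w| := by linarith
    have hfar (w : ℝ) (hw : 1 / 2 < σ * |w|) (hwpos : 0 < |w|) :
        |ζ (w + σ * w ^ 2)| ≤ N * (Icc (-1 / σ - 2) (-1 / σ + 2)).indicator 1 w := by
      rcases lt_or_ge |w + σ * w ^ 2| 1 with h1 | h1
      · have h2 : |w| * |1 + σ * w| < 1 := by
          have : w * (1 + σ * w) = w + σ * w ^ 2 := by ring
          rwa [← abs_mul, this]
        -- Since |w| > 1/(2σ), the bound |w||1 + σw| < 1 confines w to within 2 of -1/σ.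
        have h3 : |1 + σ * w| ≤ 2 * σ := by
          by_contra! h
          nlinarith [mul_lt_mul_of_pos_left h hwpos]
        rw [abs_le] at h3
        have h4 : σ * (-1 / σ) = -1 := by field_simp
        rw [indicator_of_mem (show w ∈ Icc (-1 / σ - 2) (-1 / σ + 2) from
          ⟨by nlinarith, by nlinarith⟩), Pi.one_apply, mul_one]
        exact hN _
      · rw [hζ.eq_zero h1, abs_zero]
        exact mul_nonneg hN0 (indicator_nonneg (fun _ _ => zero_le_one) w)
    have h1 := hfar w hw hwpos
    have h2 : |ζ (w - σ * w ^ 2)| ≤ N * (Icc (1 / σ - 2) (1 / σ + 2)).indicator 1 w := by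
      have h := hfar (-w) (by rwa [abs_neg]) (by rwa [abs_neg])
      have e1 : -w + σ * (-w) ^ 2 = -(w - σ * w ^ 2) := by ring
      have e2 : -w ∈ Icc (-1 / σ - 2) (-1 / σ + 2) ↔ w ∈ Icc (1 / σ - 2) (1 / σ + 2) := by
        rw [neg_div, mem_Icc, mem_Icc]
        constructor <;> rintro ⟨_, _⟩ <;> constructor <;> linarith
      rw [e1, hζ.symm] at h
      simpa only [indicator, e2, Pi.one_apply] using h
    have h3 : singWeight s w ≤ 2 ^ (1 + 2 * s) * σ ^ (1 + 2 * s) := by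
      refine (singWeight_le hs (by positivity) hw').trans (le_of_eq ?_)
      rw [← Real.mul_rpow zero_le_two hσ.le, one_div, Real.inv_rpow (by positivity),
        ← Real.rpow_neg (by positivity)]
      ring_nf
    rw [hζ.eq_zero hw1, mul_zero, zero_sub]
    calc _ ≤ (N * (Icc (-1 / σ - 2) (-1 / σ + 2)).indicator 1 w
          + N * (Icc (1 / σ - 2) (1 / σ + 2)).indicator 1 w)
            * (2 ^ (1 + 2 * s) * σ ^ (1 + 2 * s)) := by
          refine mul_le_mul ((abs_sub _ _).trans ?_) h3 hW
            (add_nonneg (mul_nonneg hN0 (hi _)) (mul_nonneg hN0 (hi _)))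
          rw [abs_neg]
          exact add_le_add h1 h2
      _ = _ := by rw [hC₂]; ring

/-- Averaging the integral with its reflection cancels the first-order term in σ; each of the three
intervals in the pointwise bound has length 4. -/
theorem IsSymmCutoff.exists_abs_integral_difference_le {ζ : ℝ → ℝ} (hζ : IsSymmCutoff ζ) {s : ℝ}
    (hs : 0 < s) : ∃ C, 0 ≤ C ∧ ∀ σ : ℝ, 0 < σ → σ ≤ 1 / 8 →
      Integrable (fun w => (ζ w - ζ (w + σ * w ^ 2)) * singWeight s w) →
      |∫ w, (ζ w - ζ (w + σ * w ^ 2)) * singWeight s w| ≤ C * (σ ^ 2 + σ ^ (1 + 2 * s)) := by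
  obtain ⟨C, hC, hle⟩ := hζ.exists_symmetrized_difference_le hs
  refine ⟨4 * C, by positivity, fun σ hσ hσ8 hi => ?_⟩
  have h1 : 2 * ∫ w, (ζ w - ζ (w + σ * w ^ 2)) * singWeight s w =
      ∫ w, (2 * ζ w - ζ (w + σ * w ^ 2) - ζ (w - σ * w ^ 2)) * singWeight s w := by
    have h2 := integral_neg_eq_self (fun w => (ζ w - ζ (w + σ * w ^ 2)) * singWeight s w) volume
    rw [two_mul]
    nth_rewrite 2 [← h2]
    rw [← integral_add hi hi.comp_neg]
    congr 1 with w
    have h3 : ζ (-w + σ * (-w) ^ 2) = ζ (w - σ * w ^ 2) := by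
      rw [← hζ.symm]; congr 1; ring
    rw [h3, hζ.symm, singWeight_neg]
    ring
  have hint (a b : ℝ) : Integrable ((Icc a b).indicator (1 : ℝ → ℝ)) :=
    (integrable_indicator_iff measurableSet_Icc).2 (integrableOn_const (by simp))
  have hval (a b : ℝ) (hab : a ≤ b) : ∫ w, (Icc a b).indicator (1 : ℝ → ℝ) w = b - a := by
    rw [integral_indicator_one measurableSet_Icc, Real.volume_real_Icc_of_le hab]
  have e1 := (hint (-2) 2).const_mul (σ ^ 2)
  have e2 := (hint (-1 / σ - 2) (-1 / σ + 2))
  have e3 := (hint (1 / σ - 2) (1 / σ + 2))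
  have e4 : Integrable fun w => σ ^ (1 + 2 * s) *
      ((Icc (-1 / σ - 2) (-1 / σ + 2)).indicator (1 : ℝ → ℝ) w
        + (Icc (1 / σ - 2) (1 / σ + 2)).indicator 1 w) := (e2.add e3).const_mul _
  have h4 : |2 * ∫ w, (ζ w - ζ (w + σ * w ^ 2)) * singWeight s w| ≤
      ∫ w, C * (σ ^ 2 * (Icc (-2) 2).indicator 1 w
          + σ ^ (1 + 2 * s) * ((Icc (-1 / σ - 2) (-1 / σ + 2)).indicator 1 w
            + (Icc (1 / σ - 2) (1 / σ + 2)).indicator 1 w)) := by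
    rw [h1, ← Real.norm_eq_abs]
    refine norm_integral_le_of_norm_le ((e1.add e4).const_mul C) (ae_of_all _ fun w => ?_)
    rw [norm_mul, Real.norm_of_nonneg (singWeight_nonneg _ _)]
    exact hle σ hσ hσ8 w
  rw [integral_const_mul, integral_add e1 e4, integral_const_mul, integral_const_mul,
    integral_add e2 e3, hval _ _ (by norm_num), hval _ _ (by linarith), hval _ _ (by linarith),
    abs_mul, abs_two] at h4
  have h5 : 0 ≤ σ ^ (1 + 2 * s) := by positivity
  nlinarith [mul_nonneg hC h5, mul_nonneg hC (sq_nonneg σ)]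

/-- With w = xz the phase becomes w + w²/(2x²), and homogeneity of the weight extracts |x|^(2s). -/
theorem kernelRemainder_eq {φ : ℝ → ℝ} (hφ : IsEvenBump φ) {s : ℝ} (hs₀ : 0 < s) (hs₁ : s < 1)
    {x : ℝ} (hx : x ≠ 0) :
    Integrable (fun w => (φ w - φ (w + 1 / (2 * x ^ 2) * w ^ 2)) * singWeight s w) ∧
    kernelRemainder s φ x =
      |x| ^ (2 * s) * ∫ w, (φ w - φ (w + 1 / (2 * x ^ 2) * w ^ 2)) * singWeight s w := by
  set F : ℝ → ℝ := fun w => 1 - φ (w + 1 / (2 * x ^ 2) * w ^ 2) with hF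
  have hFx (z : ℝ) : F (x * z) = 1 - φ (halfSqDiff x z) := by
    simp only [hF, halfSqDiff]; congr 2; field_simp
  have h1 := integral_comp_mul_singWeight s F hx
  have h2 : Integrable fun w => F w * singWeight s w := by
    have hi := hφ.integrable_one_sub_halfSqDiff_mul_singWeight hs₀ hs₁ x
    simp_rw [← hFx] at hi
    simpa [hx] using integrable_comp_mul_singWeight (F := fun z => F (x * z)) (inv_ne_zero hx) hi
  have h3 := hφ.integrable_one_sub_mul_singWeight hs₀ hs₁
  have h4 : (fun w => (φ w - φ (w + 1 / (2 * x ^ 2) * w ^ 2)) * singWeight s w) =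
      fun w => F w * singWeight s w - (1 - φ w) * singWeight s w := by
    funext w; simp only [hF]; ring
  rw [h4]
  refine ⟨h2.sub h3, ?_⟩
  rw [integral_sub h2 h3, kernelRemainder, cutoffKernel, kernelConst]
  simp_rw [← hFx]
  rw [h1]
  ring

theorem one_le_japan (x : ℝ) : 1 ≤ japan x := by
  rw [japan, Real.one_le_sqrt]
  nlinarith [sq_nonneg |x|]

theorem abs_le_japan (x : ℝ) : |x| ≤ japan x := Real.le_sqrt_of_sq_le (by linarith)

theorem japan_le_one_add_abs (x : ℝ) : japan x ≤ 1 + |x| := by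
  rw [japan, Real.sqrt_le_left (by positivity)]
  nlinarith [abs_nonneg x]

/-- The remainder of the cutoff kernel is `O(⟨x⟩^p)` for `2s - 4 ≤ p` and `-2 - 2s ≤ p`. -/
theorem IsSymmCutoff.exists_abs_kernelRemainder_le {ζ : ℝ → ℝ} (hζ : IsSymmCutoff ζ) {s p : ℝ}
    (hs₀ : 0 < s) (hs₁ : s < 1) (hp : p ≤ 0) (hp₁ : 2 * s - 4 ≤ p) (hp₂ : -2 - 2 * s ≤ p) :
    ∃ C, 0 ≤ C ∧ ∀ x, |kernelRemainder s ζ x| ≤ C * japan x ^ p := by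
  obtain ⟨C₁, hC₁, h₁⟩ := hζ.exists_abs_integral_difference_le hs₀
  obtain ⟨C₂, hC₂, h₂⟩ := hζ.isEvenBump.exists_abs_cutoffKernel_le hs₀ hs₁
  set C₃ := C₂ * (1 + 2 ^ (2 * s)) + |kernelConst s ζ| * 2 ^ (2 * s) with hC₃
  have hC₃0 : 0 ≤ C₃ := by positivity
  refine ⟨2 * C₁ * 2 ^ (-p) + C₃ * 3 ^ (-p), by positivity, fun x => ?_⟩
  have hj := one_le_japan x
  -- For |x| > 2 the parameter σ = 1/(2x²) is below 1/8, and |x|^(2s)(σ² + σ^(1+2s)) yields the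
  -- exponents 2s - 4 and -2 - 2s. For |x| ≤ 2 boundedness suffices, as ⟨x⟩ ≤ 3.
  rcases le_or_gt |x| 2 with hx | hx
  · have h3 : |x| ^ (2 * s) ≤ 2 ^ (2 * s) := Real.rpow_le_rpow (abs_nonneg _) hx (by positivity)
    have h4 : |kernelRemainder s ζ x| ≤ C₃ := by
      refine (abs_sub _ _).trans (add_le_add ((h₂ x).trans ?_) ?_)
      · gcongr
      · rw [abs_mul, abs_of_nonneg (by positivity : 0 ≤ |x| ^ (2 * s))]
        gcongr
    have h5 : (3 : ℝ) ^ p ≤ japan x ^ p :=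
      Real.rpow_le_rpow_of_nonpos (by linarith) (by linarith [japan_le_one_add_abs x]) hp
    have h6 : (1 : ℝ) ≤ 3 ^ (-p) * japan x ^ p := by
      calc (1 : ℝ) = 3 ^ (-p) * 3 ^ p := by rw [← Real.rpow_add (by norm_num)]; simp
        _ ≤ _ := by gcongr
    calc _ ≤ C₃ * 1 := by rw [mul_one]; exact h4
      _ ≤ C₃ * (3 ^ (-p) * japan x ^ p) := by gcongr
      _ ≤ _ := by
        rw [add_mul (2 * C₁ * 2 ^ (-p)), mul_assoc C₃]
        exact le_add_of_nonneg_left (by positivity)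
  · have hx0 : x ≠ 0 := by rintro rfl; norm_num at hx
    have hxp : 0 < |x| := abs_pos.2 hx0
    obtain ⟨hi, heq⟩ := kernelRemainder_eq hζ.isEvenBump hs₀ hs₁ hx0
    have hx2 : 0 < x ^ 2 := by positivity
    have hx4 : 4 ≤ x ^ 2 := by rw [← sq_abs]; nlinarith
    have hσ : 1 / (2 * x ^ 2) ≤ 1 / 8 := by
      apply one_div_le_one_div_of_le <;> linarith
    have h3 := h₁ _ (by positivity) hσ hi
    have h4 : 1 / (2 * x ^ 2) ≤ |x| ^ (-2 : ℝ) := by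
      rw [Real.rpow_neg hxp.le, Real.rpow_two, sq_abs, ← one_div]
      apply one_div_le_one_div_of_le <;> linarith
    have h5 : (1 / (2 * x ^ 2)) ^ 2 ≤ |x| ^ (-4 : ℝ) := by
      refine (pow_le_pow_left₀ (by positivity) h4 2).trans (le_of_eq ?_)
      rw [← Real.rpow_mul_natCast hxp.le]; norm_num
    have h6 : (1 / (2 * x ^ 2)) ^ (1 + 2 * s) ≤ |x| ^ (-2 - 4 * s) := by
      refine (Real.rpow_le_rpow (by positivity) h4 (by linarith)).trans (le_of_eq ?_)
      rw [← Real.rpow_mul hxp.le]; ring_nf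
    have h1x : 1 ≤ |x| := by linarith
    have h7 : |x| ^ (2 * s) * |x| ^ (-4 : ℝ) ≤ |x| ^ p := by
      rw [← Real.rpow_add hxp]
      exact Real.rpow_le_rpow_of_exponent_le h1x (by linarith)
    have h8 : |x| ^ (2 * s) * |x| ^ (-2 - 4 * s) ≤ |x| ^ p := by
      rw [← Real.rpow_add hxp]
      exact Real.rpow_le_rpow_of_exponent_le h1x (by linarith)
    have h9 : |x| ^ p ≤ 2 ^ (-p) * japan x ^ p := by
      calc |x| ^ p ≤ (japan x / 2) ^ p := Real.rpow_le_rpow_of_nonpos (by linarith)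
            (by linarith [japan_le_one_add_abs x]) hp
        _ = _ := by
          rw [Real.div_rpow (by linarith) (by norm_num), Real.rpow_neg (by norm_num),
            div_eq_inv_mul]
    rw [heq, abs_mul, abs_of_nonneg (by positivity : 0 ≤ |x| ^ (2 * s))]
    calc _ ≤ |x| ^ (2 * s) * (C₁ * (|x| ^ (-4 : ℝ) + |x| ^ (-2 - 4 * s))) := by
          refine mul_le_mul_of_nonneg_left (h3.trans ?_) (by positivity)
          gcongr
      _ = C₁ * (|x| ^ (2 * s) * |x| ^ (-4 : ℝ) + |x| ^ (2 * s) * |x| ^ (-2 - 4 * s)) := by ring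
      _ ≤ C₁ * (2 ^ (-p) * japan x ^ p + 2 ^ (-p) * japan x ^ p) :=
          mul_le_mul_of_nonneg_left (add_le_add (h7.trans h9) (h8.trans h9)) hC₁
      _ = 2 * C₁ * 2 ^ (-p) * japan x ^ p := by ring
      _ ≤ _ := by
        rw [add_mul]
        exact le_add_of_nonneg_right (by positivity)

/-! ### The fractional Hardy inequality by dilation and absorption. -/

theorem ofReal_abs_mul_lintegral_comp_mul_left {F : ℝ → ENNReal} (hF : Measurable F) {a : ℝ}
    (ha : a ≠ 0) : ENNReal.ofReal |a| * ∫⁻ x, F (a * x) = ∫⁻ x, F x := by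
  rw [← lintegral_map (μ := volume) (f := F) (g := fun x => a * x) hF (by fun_prop),
    ← smul_eq_mul, ← lintegral_smul_measure, Real.smul_map_volume_mul_left ha]

theorem norm_sq_le_of_pos {κ : ℝ} (hκ : 0 < κ) (a b : ℂ) :
    ‖a‖ ^ 2 ≤ (1 + κ) * ‖b‖ ^ 2 + (1 + κ⁻¹) * ‖b - a‖ ^ 2 := by
  have h : ‖a‖ ≤ ‖b‖ + ‖b - a‖ := by
    have := norm_sub_le b (b - a)
    simpa using this
  have h1 := pow_le_pow_left₀ (norm_nonneg _) h 2
  have h2 : 0 ≤ κ⁻¹ * (κ * ‖b‖ - ‖b - a‖) ^ 2 := by positivity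
  have h3 : κ⁻¹ * (κ * ‖b‖ - ‖b - a‖) ^ 2 =
      κ * ‖b‖ ^ 2 + κ⁻¹ * ‖b - a‖ ^ 2 - 2 * ‖b‖ * ‖b - a‖ := by
    field_simp; ring
  linarith

/-- The substitution z = μξ with 1 ≤ μ ≤ 2 covers part of the inner Gagliardo integral, on which |z|
and |ξ| are comparable. -/
theorem lintegral_dilation_diff_le {s : ℝ} (hs : 0 < s) {g : ℝ → ℂ} (hg : Measurable g) :
    ∫⁻ μ in Icc (1 : ℝ) 2, ∫⁻ ξ,
        ENNReal.ofReal (‖g (ξ + μ * ξ) - g ξ‖ ^ 2 * |ξ| ^ (-(2 * s))) ≤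
      ENNReal.ofReal (2 ^ (1 + 2 * s)) * gagliardo s g := by
  rw [lintegral_lintegral_swap (Measurable.aemeasurable (by fun_prop)), gagliardo,
    Measure.volume_eq_prod, lintegral_prod _ (Measurable.aemeasurable (by fun_prop)),
    ← lintegral_const_mul' _ _ (by simp)]
  refine lintegral_mono_ae ?_
  filter_upwards [Measure.ae_ne volume (0 : ℝ)] with ξ hξ
  set H : ℝ → ENNReal := fun z => ENNReal.ofReal (‖g (ξ + z) - g ξ‖ ^ 2 * singWeight s z)
    with hH
  have hHm : Measurable H := by fun_prop
  rw [← ofReal_abs_mul_lintegral_comp_mul_left hHm hξ, ← mul_assoc,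
    ← ENNReal.ofReal_mul (by positivity), ← lintegral_const_mul' _ _ (by simp)]
  refine (setLIntegral_mono (g := fun μ => ENNReal.ofReal (2 ^ (1 + 2 * s) * |ξ|) * H (ξ * μ))
    (by fun_prop) fun μ hμ => ?_).trans (setLIntegral_le_lintegral _ _)
  rw [hH, ← ENNReal.ofReal_mul (by positivity)]
  apply ENNReal.ofReal_le_ofReal
  have hμ0 : 0 < μ := by linarith [hμ.1]
  have hξ0 : 0 < |ξ| := abs_pos.2 hξ
  have h1 : |ξ| ^ (-(2 * s)) = μ ^ (1 + 2 * s) * |ξ| * singWeight s (ξ * μ) := by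
    rw [singWeight, abs_mul, abs_of_pos hμ0, Real.mul_rpow hξ0.le hμ0.le,
      show -1 - 2 * s = -(1 + 2 * s) by ring, Real.rpow_neg hμ0.le]
    have : μ ^ (1 + 2 * s) ≠ 0 := (Real.rpow_pos_of_pos hμ0 _).ne'
    have h2 : |ξ| ^ (-(2 * s)) = |ξ| * |ξ| ^ (-(1 + 2 * s)) := by
      nth_rewrite 2 [← Real.rpow_one |ξ|]
      rw [← Real.rpow_add hξ0]; ring_nf
    rw [h2]
    field_simp
  rw [h1, mul_comm ξ μ]
  have h3 : μ ^ (1 + 2 * s) ≤ 2 ^ (1 + 2 * s) := Real.rpow_le_rpow hμ0.le hμ.2 (by linarith)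
  have h4 := singWeight_nonneg s (μ * ξ)
  calc _ ≤ ‖g (ξ + μ * ξ) - g ξ‖ ^ 2 * (2 ^ (1 + 2 * s) * |ξ| * singWeight s (μ * ξ)) := by gcongr
    _ = _ := by ring

/-- A dilation by l = 1 + μ ≥ 2 gains l⁻¹ from the Jacobian and loses at most l^(2s) from the
weight. Since s < 1/2 this is a strict contraction; ρ > 0 keeps the weight bounded. -/
theorem lintegral_regularized_dilation_le {s ρ μ : ℝ} (hs : 0 < s) (hs' : s < 1 / 2) (hρ : 0 < ρ)
    (hμ : 1 ≤ μ) {g : ℝ → ℂ} (hg : Measurable g) :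
    ∫⁻ ξ, ENNReal.ofReal (‖g (ξ + μ * ξ)‖ ^ 2 * (|ξ| + ρ) ^ (-(2 * s))) ≤
      ENNReal.ofReal (2 ^ (2 * s - 1)) *
        ∫⁻ ξ, ENNReal.ofReal (‖g ξ‖ ^ 2 * (|ξ| + ρ) ^ (-(2 * s))) := by
  set l := 1 + μ with hl
  have hl2 : 2 ≤ l := by linarith
  have hl0 : 0 < l := by linarith
  have hm : Measurable fun η : ℝ => ENNReal.ofReal (‖g η‖ ^ 2 * (|η / l| + ρ) ^ (-(2 * s))) := by
    fun_prop
  have h1 := ofReal_abs_mul_lintegral_comp_mul_left hm hl0.ne'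
  have h2 (ξ : ℝ) : ξ + μ * ξ = l * ξ := by rw [hl]; ring
  simp_rw [mul_div_cancel_left₀ _ hl0.ne'] at h1
  simp_rw [h2]
  have h3 : ∫⁻ ξ, ENNReal.ofReal (‖g (l * ξ)‖ ^ 2 * (|ξ| + ρ) ^ (-(2 * s))) =
      ENNReal.ofReal l⁻¹ * ∫⁻ η, ENNReal.ofReal (‖g η‖ ^ 2 * (|η / l| + ρ) ^ (-(2 * s))) := by
    rw [← h1, ← mul_assoc, ← ENNReal.ofReal_mul (by positivity), abs_of_pos hl0,
      inv_mul_cancel₀ hl0.ne', ENNReal.ofReal_one, one_mul]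
  rw [h3, ← lintegral_const_mul' _ _ (by simp), ← lintegral_const_mul' _ _ (by simp)]
  refine lintegral_mono fun η => ?_
  simp only
  rw [← ENNReal.ofReal_mul (by positivity), ← ENNReal.ofReal_mul (by positivity)]
  apply ENNReal.ofReal_le_ofReal
  have h4 : (|η / l| + ρ) ^ (-(2 * s)) ≤ l ^ (2 * s) * (|η| + ρ) ^ (-(2 * s)) := by
    calc (|η / l| + ρ) ^ (-(2 * s)) ≤ ((|η| + ρ) / l) ^ (-(2 * s)) := by
          refine Real.rpow_le_rpow_of_nonpos (by positivity) ?_ (by linarith)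
          rw [abs_div, abs_of_pos hl0, add_div]
          gcongr
          exact div_le_self hρ.le (by linarith)
      _ = _ := by
          rw [Real.div_rpow (by positivity) hl0.le, Real.rpow_neg hl0.le, div_inv_eq_mul, mul_comm]
  have h5 : l⁻¹ * l ^ (2 * s) ≤ 2 ^ (2 * s - 1) := by
    rw [← Real.rpow_neg_one, ← Real.rpow_add hl0, neg_add_eq_sub]
    exact Real.rpow_le_rpow_of_nonpos (by norm_num) hl2 (by linarith)
  calc l⁻¹ * (‖g η‖ ^ 2 * (|η / l| + ρ) ^ (-(2 * s)))
      ≤ l⁻¹ * (‖g η‖ ^ 2 * (l ^ (2 * s) * (|η| + ρ) ^ (-(2 * s)))) := by gcongr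
    _ = l⁻¹ * l ^ (2 * s) * (‖g η‖ ^ 2 * (|η| + ρ) ^ (-(2 * s))) := by ring
    _ ≤ _ := by gcongr

/-- The fractional Hardy inequality, in qualitative form. -/
theorem integrable_rpow_neg_mul_norm_sq {s : ℝ} (hs : 0 < s) (hs' : s < 1 / 2) {g : ℝ → ℂ}
    (hg : Measurable g) (hg2 : Integrable fun ξ => ‖g ξ‖ ^ 2) (hE : gagliardo s g ≠ ⊤) :
    Integrable fun ξ : ℝ => |ξ| ^ (-(2 * s)) * ‖g ξ‖ ^ 2 := by
  set q : ℝ := 2 ^ (2 * s - 1) with hq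
  have hq0 : 0 < q := by positivity
  have hq1 : q < 1 := Real.rpow_lt_one_of_one_lt_of_neg (by norm_num) (by linarith)
  -- Chosen so that (1 + κ)q = (1 + q)/2 < 1: the contraction survives Young's inequality.
  set κ : ℝ := (q⁻¹ - 1) / 2 with hκ
  have hκ0 : 0 < κ := by
    have := (one_lt_inv₀ hq0).2 hq1
    simp only [hκ]; linarith
  have hθ : (1 + κ) * q = (1 + q) / 2 := by rw [hκ]; field_simp; ring
  set e : ℝ := (1 + κ⁻¹) * (2 ^ (1 + 2 * s) * (gagliardo s g).toReal) with he
  have he0 : 0 ≤ e := by positivity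
  set W : ℝ → ENNReal := fun ρ => ∫⁻ ξ, ENNReal.ofReal (‖g ξ‖ ^ 2 * (|ξ| + ρ) ^ (-(2 * s)))
    with hW
  have hfin (ρ : ℝ) (hρ : 0 < ρ) : W ρ ≠ ⊤ := by
    have hb : Integrable fun ξ : ℝ => ‖g ξ‖ ^ 2 * (|ξ| + ρ) ^ (-(2 * s)) := by
      refine (hg2.mul_const (ρ ^ (-(2 * s)))).mono' (Measurable.aestronglyMeasurable (by fun_prop))
        (ae_of_all _ fun ξ => ?_)
      rw [Real.norm_of_nonneg (by positivity)]
      exact mul_le_mul_of_nonneg_left (Real.rpow_le_rpow_of_nonpos hρ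
        (by linarith [abs_nonneg ξ]) (by linarith)) (sq_nonneg _)
    exact hb.lintegral_lt_top.ne
  have hstep (ρ : ℝ) (hρ : 0 < ρ) :
      W ρ ≤ ENNReal.ofReal ((1 + q) / 2) * W ρ + ENNReal.ofReal e := by
    have h1 (μ : ℝ) (hμ : μ ∈ Icc (1 : ℝ) 2) : W ρ ≤ ENNReal.ofReal ((1 + q) / 2) * W ρ +
        ENNReal.ofReal (1 + κ⁻¹) * ∫⁻ ξ,
          ENNReal.ofReal (‖g (ξ + μ * ξ) - g ξ‖ ^ 2 * |ξ| ^ (-(2 * s))) := by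
      calc W ρ ≤ ∫⁻ ξ, (ENNReal.ofReal (1 + κ) *
            ENNReal.ofReal (‖g (ξ + μ * ξ)‖ ^ 2 * (|ξ| + ρ) ^ (-(2 * s))) +
            ENNReal.ofReal (1 + κ⁻¹) *
              ENNReal.ofReal (‖g (ξ + μ * ξ) - g ξ‖ ^ 2 * |ξ| ^ (-(2 * s)))) := by
            refine lintegral_mono_ae ?_
            filter_upwards [Measure.ae_ne volume (0 : ℝ)] with ξ hξ
            rw [← ENNReal.ofReal_mul (by positivity), ← ENNReal.ofReal_mul (by positivity),
              ← ENNReal.ofReal_add (by positivity) (by positivity)]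
            apply ENNReal.ofReal_le_ofReal
            have h2 : (|ξ| + ρ) ^ (-(2 * s)) ≤ |ξ| ^ (-(2 * s)) :=
              Real.rpow_le_rpow_of_nonpos (abs_pos.2 hξ) (by linarith) (by linarith)
            calc _ ≤ ((1 + κ) * ‖g (ξ + μ * ξ)‖ ^ 2 + (1 + κ⁻¹) * ‖g (ξ + μ * ξ) - g ξ‖ ^ 2)
                  * (|ξ| + ρ) ^ (-(2 * s)) := by
                  gcongr; exact norm_sq_le_of_pos hκ0 _ _
              _ = (1 + κ) * (‖g (ξ + μ * ξ)‖ ^ 2 * (|ξ| + ρ) ^ (-(2 * s)))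
                  + (1 + κ⁻¹) * (‖g (ξ + μ * ξ) - g ξ‖ ^ 2 * (|ξ| + ρ) ^ (-(2 * s))) := by ring
              _ ≤ _ := by gcongr
        _ = ENNReal.ofReal (1 + κ) * (∫⁻ ξ,
              ENNReal.ofReal (‖g (ξ + μ * ξ)‖ ^ 2 * (|ξ| + ρ) ^ (-(2 * s)))) +
            ENNReal.ofReal (1 + κ⁻¹) * ∫⁻ ξ,
              ENNReal.ofReal (‖g (ξ + μ * ξ) - g ξ‖ ^ 2 * |ξ| ^ (-(2 * s))) := by
            rw [lintegral_add_left (by fun_prop), lintegral_const_mul' _ _ (by simp),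
              lintegral_const_mul' _ _ (by simp)]
        _ ≤ ENNReal.ofReal (1 + κ) * (ENNReal.ofReal q * W ρ) + _ := by
            gcongr
            exact lintegral_regularized_dilation_le hs hs' hρ hμ.1 hg
        _ = _ := by rw [← mul_assoc, ← ENNReal.ofReal_mul (by positivity), hθ]
    have hvol : volume (Icc (1 : ℝ) 2) = 1 := by rw [Real.volume_Icc]; norm_num
    calc W ρ = ∫⁻ _ in Icc (1 : ℝ) 2, W ρ := by rw [setLIntegral_const, hvol, mul_one]
      _ ≤ ∫⁻ μ in Icc (1 : ℝ) 2, (ENNReal.ofReal ((1 + q) / 2) * W ρ +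
          ENNReal.ofReal (1 + κ⁻¹) * ∫⁻ ξ,
          ENNReal.ofReal (‖g (ξ + μ * ξ) - g ξ‖ ^ 2 * |ξ| ^ (-(2 * s)))) :=
          setLIntegral_mono' measurableSet_Icc h1
      _ = ENNReal.ofReal ((1 + q) / 2) * W ρ + ENNReal.ofReal (1 + κ⁻¹) *
          ∫⁻ μ in Icc (1 : ℝ) 2, ∫⁻ ξ,
          ENNReal.ofReal (‖g (ξ + μ * ξ) - g ξ‖ ^ 2 * |ξ| ^ (-(2 * s))) := by
          rw [lintegral_add_left (by fun_prop), setLIntegral_const, hvol, mul_one,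
            lintegral_const_mul' _ _ (by simp)]
      _ ≤ ENNReal.ofReal ((1 + q) / 2) * W ρ + ENNReal.ofReal (1 + κ⁻¹) *
          (ENNReal.ofReal (2 ^ (1 + 2 * s)) * gagliardo s g) := by
          gcongr; exact lintegral_dilation_diff_le hs hg
      _ = _ := by
          rw [he, ENNReal.ofReal_mul (by positivity), ENNReal.ofReal_mul (by positivity),
            ENNReal.ofReal_toReal hE]
  -- Finiteness of W ρ permits absorbing its multiple on the right; the resulting bound does not
  -- depend on ρ, and Fatou's lemma then removes the regularization.
  have hbound (ρ : ℝ) (hρ : 0 < ρ) : W ρ ≤ ENNReal.ofReal (2 * e / (1 - q)) := by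
    have h1 := hstep ρ hρ
    rw [← ENNReal.ofReal_toReal (hfin ρ hρ)] at h1 ⊢
    rw [← ENNReal.ofReal_mul (by positivity), ← ENNReal.ofReal_add (by positivity) he0,
      ENNReal.ofReal_le_ofReal_iff (by positivity)] at h1
    apply ENNReal.ofReal_le_ofReal
    rw [le_div_iff₀ (by linarith)]
    linarith
  have hlim : ∀ᵐ ξ : ℝ, Tendsto (fun n : ℕ => ENNReal.ofReal
      (‖g ξ‖ ^ 2 * (|ξ| + 1 / ((n : ℝ) + 1)) ^ (-(2 * s)))) atTop
      (𝓝 (ENNReal.ofReal (|ξ| ^ (-(2 * s)) * ‖g ξ‖ ^ 2))) := by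
    filter_upwards [Measure.ae_ne volume (0 : ℝ)] with ξ hξ
    refine (ENNReal.continuous_ofReal.tendsto _).comp ?_
    have h1 : Tendsto (fun n : ℕ => |ξ| + 1 / ((n : ℝ) + 1)) atTop (𝓝 |ξ|) := by
      simpa using tendsto_one_div_add_atTop_nhds_zero_nat.const_add |ξ|
    rw [mul_comm (|ξ| ^ _)]
    exact (h1.rpow_const (Or.inl (abs_ne_zero.2 hξ))).const_mul _
  refine (lintegral_ofReal_ne_top_iff_integrable (Measurable.aestronglyMeasurable (by fun_prop))
    (ae_of_all _ fun ξ => by positivity)).1 (ne_top_of_le_ne_top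
      (ENNReal.ofReal_ne_top (r := 2 * e / (1 - q))) ?_)
  calc _ = ∫⁻ ξ, liminf (fun n : ℕ => ENNReal.ofReal
        (‖g ξ‖ ^ 2 * (|ξ| + 1 / ((n : ℝ) + 1)) ^ (-(2 * s)))) atTop := by
        refine lintegral_congr_ae ?_
        filter_upwards [hlim] with ξ hξ
        exact hξ.liminf_eq.symm
    _ ≤ liminf (fun n : ℕ => W (1 / ((n : ℝ) + 1))) atTop :=
        lintegral_liminf_le fun n => by fun_prop
    _ ≤ _ := liminf_le_of_le (by isBoundedDefault) fun b hb => by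
        obtain ⟨n, hn⟩ := hb.exists
        exact hn.trans (hbound _ (by positivity))

/-! ### Data in Σ_δ: Hardy weights, integrability, Hölder continuity at the origin. -/

/-- If `f` and `|x|^δ f` are square integrable, then so is `|x|^s f` for `s ≤ δ`; on the Fourier
side the Gagliardo energy of order `s` is finite. -/
theorem gagliardo_fourier_ne_top {δ s : ℝ} (hs₀ : 0 < s) (hs₁ : s < 1) (hsδ : s ≤ δ) {f : L2R}
    (hf : Integrable fun x => |x| ^ (2 * δ) * ‖f x‖ ^ 2) (hf2 : Integrable fun x => ‖f x‖ ^ 2) :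
    gagliardo s (𝓕 f : L2R) ≠ ⊤ := by
  have hm : Measurable (f : ℝ → ℂ) := (Lp.stronglyMeasurable f).measurable
  rw [gagliardo_fourier hs₀ hs₁]
  have h : Integrable fun x : ℝ => |x| ^ (2 * s) * ‖f x‖ ^ 2 := by
    refine (hf2.add hf).mono' (Measurable.aestronglyMeasurable (by fun_prop))
      (ae_of_all _ fun x => ?_)
    rw [Real.norm_of_nonneg (by positivity), Pi.add_apply, ← one_add_mul]
    gcongr
    rcases le_total |x| 1 with hx | hx
    · have := Real.rpow_le_one (abs_nonneg x) hx (by positivity : 0 ≤ 2 * s)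
      have h0 : 0 ≤ |x| ^ (2 * δ) := by positivity
      linarith
    · have := Real.rpow_le_rpow_of_exponent_le hx (by linarith : 2 * s ≤ 2 * δ)
      linarith
  exact (h.const_mul (gagliardoConst s)).lintegral_lt_top.ne

theorem integrable_rpow_neg_mul_fourier {δ s : ℝ} (hs : 0 < s) (hs' : s < 1 / 2) (hsδ : s ≤ δ)
    {f : L2R} (hf : f ∈ SigmaSpace δ) :
    Integrable fun ξ : ℝ => |ξ| ^ (-(2 * s)) * ‖(𝓕 f : L2R) ξ‖ ^ 2 :=
  integrable_rpow_neg_mul_norm_sq hs hs' (Lp.stronglyMeasurable _).measurable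
    (integrable_norm_sq_of_memLp (Lp.memLp _))
    (gagliardo_fourier_ne_top hs (by linarith) hsδ (integrable_weighted_of_memLp hf.1)
      (integrable_norm_sq_of_memLp (Lp.memLp _)))

/-- By the arithmetic–geometric mean inequality |f| is dominated by (1+|x|)^(2δ)|f|² +
(1+|x|)^(-2δ); the last term is integrable because 2δ > 1. -/
theorem integrable_of_mem_sigmaSpace {δ : ℝ} (hδ : 1 / 2 < δ) {f : L2R} (hf : f ∈ SigmaSpace δ) :
    Integrable (f : ℝ → ℂ) := by
  have h1 := integrable_weighted_of_memLp hf.1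
  have h2 : Integrable fun x => ‖f x‖ ^ 2 := integrable_norm_sq_of_memLp (Lp.memLp f)
  have h3 : Integrable fun x : ℝ => (1 + ‖x‖) ^ (-(2 * δ)) :=
    integrable_one_add_norm (by simp; linarith)
  refine (((h2.add h1).const_mul (2 ^ (2 * δ))).add h3).mono' (Lp.aestronglyMeasurable f)
    (ae_of_all _ fun x => ?_)
  simp only [Pi.add_apply, Real.norm_eq_abs x]
  have hx : 0 < 1 + |x| := by positivity
  have h4 : (1 + |x|) ^ (2 * δ) ≤ 2 ^ (2 * δ) * (1 + |x| ^ (2 * δ)) := by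
    rcases le_total |x| 1 with h | h
    · calc (1 + |x|) ^ (2 * δ) ≤ 2 ^ (2 * δ) * 1 := by
            rw [mul_one]; exact Real.rpow_le_rpow hx.le (by linarith) (by linarith)
        _ ≤ _ := by gcongr; exact le_add_of_nonneg_right (by positivity)
    · calc (1 + |x|) ^ (2 * δ) ≤ (2 * |x|) ^ (2 * δ) :=
            Real.rpow_le_rpow hx.le (by linarith) (by linarith)
        _ = 2 ^ (2 * δ) * |x| ^ (2 * δ) := Real.mul_rpow zero_le_two (abs_nonneg x)
        _ ≤ _ := by gcongr; exact le_add_of_nonneg_left zero_le_one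
  have h5 : 0 < (1 + |x|) ^ (-(2 * δ)) := by positivity
  have h6 : (1 + |x|) ^ (2 * δ) * (1 + |x|) ^ (-(2 * δ)) = 1 := by
    rw [← Real.rpow_add hx]; simp
  have h7 : ‖f x‖ ≤ (1 + |x|) ^ (2 * δ) * ‖f x‖ ^ 2 + (1 + |x|) ^ (-(2 * δ)) := by
    have h8 : 0 < (1 + |x|) ^ (2 * δ) := by positivity
    set a := (1 + |x|) ^ (2 * δ)
    set b := (1 + |x|) ^ (-(2 * δ))
    nlinarith [mul_nonneg h8.le (sq_nonneg (‖f x‖ - b)), norm_nonneg (f x)]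
  calc ‖f x‖ ≤ 2 ^ (2 * δ) * (1 + |x| ^ (2 * δ)) * ‖f x‖ ^ 2 + (1 + |x|) ^ (-(2 * δ)) :=
        h7.trans (by gcongr)
    _ = _ := by ring

/-- Pair |x|^δ f with (e(-xξ) - 1)|x|^(-δ). The squared norm of the latter is the Gagliardo constant
of order δ - 1/2 times |ξ|^(2δ-1). -/
theorem exists_norm_fourier_sub_fourier_zero_le {δ : ℝ} (hδ : 1 / 2 < δ) (hδ₁ : δ < 1) {f : L2R}
    (hf : f ∈ SigmaSpace δ) : ∃ C, 0 ≤ C ∧ ∀ ξ,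
      ‖𝓕 (f : ℝ → ℂ) ξ - 𝓕 (f : ℝ → ℂ) 0‖ ≤ C * |ξ| ^ (δ - 1 / 2) := by
  have hw := integrable_weighted_of_memLp hf.1
  have hi := integrable_of_mem_sigmaSpace hδ hf
  have hs₀ : 0 < δ - 1 / 2 := by linarith
  have hκ := gagliardoConst_pos hs₀ (by linarith : δ - 1 / 2 < 1)
  set I := ∫ x, |x| ^ (2 * δ) * ‖f x‖ ^ 2 with hI
  have hI0 : 0 ≤ I := integral_nonneg fun x => by positivity
  refine ⟨gagliardoConst (δ - 1 / 2) + I, by positivity, fun ξ => ?_⟩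
  rcases eq_or_ne ξ 0 with rfl | hξ
  · rw [sub_self, norm_zero]; positivity
  have hξ0 : 0 < |ξ| := abs_pos.2 hξ
  -- The weight in Young's inequality that balances both terms at order |ξ|^(δ-1/2).
  set L := |ξ| ^ (δ - 1 / 2) with hL
  have hL0 : 0 < L := by positivity
  have hch := integrable_norm_fourierChar_sub_one_sq_mul_singWeight hs₀
    (by linarith : δ - 1 / 2 < 1)
  have h1 := integrable_comp_mul_singWeight
    (F := fun z => ‖(Real.fourierChar (-z) : ℂ) - 1‖ ^ 2) hξ hch
  have h2 : ∫ x, ‖(Real.fourierChar (-(ξ * x)) : ℂ) - 1‖ ^ 2 * singWeight (δ - 1 / 2) x =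
      L ^ 2 * gagliardoConst (δ - 1 / 2) := by
    rw [integral_comp_mul_singWeight (δ - 1 / 2)
      (fun z => ‖(Real.fourierChar (-z) : ℂ) - 1‖ ^ 2) hξ, hL, ← Real.rpow_mul_natCast hξ0.le,
      mul_comm 2 (δ - 1 / 2)]
    rfl
  have h3 : 𝓕 (f : ℝ → ℂ) ξ - 𝓕 (f : ℝ → ℂ) 0 =
      ∫ x, ((Real.fourierChar (-(ξ * x)) : ℂ) - 1) * f x := by
    have hi' : Integrable fun x => (Real.fourierChar (-(ξ * x)) : ℂ) * f x := by
      refine hi.norm.mono' ((Continuous.aestronglyMeasurable (by fun_prop)).mul hi.1)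
        (ae_of_all _ fun x => ?_)
      rw [norm_mul, Circle.norm_coe, one_mul]
    rw [Real.fourier_real_eq, Real.fourier_real_eq]
    simp only [mul_zero, neg_zero, AddChar.map_zero_eq_one, one_smul, Circle.smul_def, smul_eq_mul,
      sub_one_mul]
    rw [integral_sub hi' hi]
    simp only [mul_comm ξ]
  rw [h3]
  calc _ ≤ ∫ x, (L⁻¹ * (‖(Real.fourierChar (-(ξ * x)) : ℂ) - 1‖ ^ 2 * singWeight (δ - 1 / 2) x)
        + L * (|x| ^ (2 * δ) * ‖f x‖ ^ 2)) := by
        refine norm_integral_le_of_norm_le ((h1.const_mul _).add (hw.const_mul _)) ?_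
        filter_upwards [Measure.ae_ne volume (0 : ℝ)] with x hx
        have hx0 : 0 < |x| := abs_pos.2 hx
        rw [norm_mul, singWeight, show -1 - 2 * (δ - 1 / 2) = -(2 * δ) by ring,
          Real.rpow_neg hx0.le]
        set a := ‖(Real.fourierChar (-(ξ * x)) : ℂ) - 1‖
        set b := ‖f x‖
        set w := |x| ^ (2 * δ) with hw
        have hw0 : 0 < w := by positivity
        have ha : 0 ≤ a := norm_nonneg _
        have hb : 0 ≤ b := norm_nonneg _
        have h4 : L⁻¹ * (a ^ 2 * w⁻¹) + L * (w * b ^ 2) =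
            L⁻¹ * w⁻¹ * (a - L * w * b) ^ 2 + 2 * (a * b) := by
          field_simp; ring
        rw [h4]
        have : 0 ≤ L⁻¹ * w⁻¹ * (a - L * w * b) ^ 2 := by positivity
        nlinarith [mul_nonneg ha hb]
    _ = _ := by
        rw [integral_add (h1.const_mul _) (hw.const_mul _), integral_const_mul, integral_const_mul,
          h2, ← hI]
        field_simp

/-! ### The Japanese bracket, and vanishing of the localized difference term. -/

theorem measurable_japan : Measurable japan := by unfold japan; fun_prop

theorem integrable_japan_rpow {p : ℝ} (hp : p < -1) : Integrable fun x => japan x ^ p := by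
  have h := integrable_rpow_neg_one_add_norm_sq (E := ℝ) (μ := volume) (r := -p)
    (by simp; linarith)
  refine h.congr (ae_of_all _ fun x => ?_)
  simp only
  rw [japan, Real.sqrt_eq_rpow, ← Real.rpow_mul (by positivity), Real.norm_eq_abs]
  ring_nf

theorem japan_div_sqrt_rpow_le {r ε ξ : ℝ} (hr : 0 ≤ r) (hε : 0 < ε) (hξ : ξ ≠ 0) :
    japan (ξ / Real.sqrt ε) ^ (-(2 * r)) ≤ ε ^ r * |ξ| ^ (-(2 * r)) := by
  have hs : 0 < Real.sqrt ε := Real.sqrt_pos.2 hε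
  have hξ0 : 0 < |ξ| := abs_pos.2 hξ
  calc japan (ξ / Real.sqrt ε) ^ (-(2 * r)) ≤ |ξ / Real.sqrt ε| ^ (-(2 * r)) :=
        Real.rpow_le_rpow_of_nonpos (by rw [abs_div]; positivity) (abs_le_japan _) (by linarith)
    _ = _ := by
        rw [abs_div, abs_of_pos hs, Real.div_rpow hξ0.le hs.le, Real.sqrt_eq_rpow,
          ← Real.rpow_mul hε.le, show 1 / 2 * -(2 * r) = -r by ring, Real.rpow_neg hε.le,
          div_inv_eq_mul, mul_comm]

theorem ae_halfSqDiff_ne_zero : ∀ᵐ p : ℝ × ℝ, halfSqDiff p.1 p.2 ≠ 0 := by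
  have hm : MeasurableSet {p : ℝ × ℝ | halfSqDiff p.1 p.2 = 0} :=
    measurableSet_eq_fun (by unfold halfSqDiff; fun_prop) measurable_const
  have h : volume {p : ℝ × ℝ | halfSqDiff p.1 p.2 = 0} = 0 := by
    rw [Measure.volume_eq_prod, Measure.measure_prod_null hm]
    refine ae_of_all _ fun ξ => ?_
    refine measure_mono_null (t := {0, -(2 * ξ)}) (fun z hz => ?_) ((toFinite _).measure_zero _)
    have hz' : z * (z + 2 * ξ) = 0 := by
      have : ξ * z + z ^ 2 / 2 = 0 := hz
      linarith
    rcases mul_eq_zero.1 hz' with h | h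
    · exact Or.inl h
    · exact Or.inr (by rw [mem_singleton_iff]; linarith)
  filter_upwards [measure_eq_zero_iff_ae_notMem.1 h] with p hp using hp

/-- The part of the pairing carried by the Gagliardo differences. -/
noncomputable def localizedGagliardo (s : ℝ) (g : ℝ → ℂ) (φ : ℝ → ℝ) : ℝ :=
  ∫ p : ℝ × ℝ, ‖g (p.1 + p.2) - g p.1‖ ^ 2 * singWeight s p.2 * φ (halfSqDiff p.1 p.2)

/-- Once ε ≤ |σ| the cutoff vanishes at σ, and σ = 0 only on a null set; the Gagliardo integrand
times a bound for ζ dominates. -/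
theorem tendsto_localizedGagliardo {s : ℝ} {g : ℝ → ℂ} (hg : IsSobolevWeighted s g) {ζ : ℝ → ℝ}
    (hζ : IsSymmCutoff ζ) :
    Tendsto (fun ε => localizedGagliardo s g (rescale ζ ε)) (𝓝[>] 0) (𝓝 0) := by
  obtain ⟨N, hN⟩ := hζ.isEvenBump.exists_abs_le
  have hgm := hg.meas
  have hζm := hζ.smooth.continuous.measurable
  conv => arg 3; rw [← integral_zero (ℝ × ℝ) ℝ (μ := volume)]
  unfold localizedGagliardo
  refine tendsto_integral_filter_of_dominated_convergence
    (fun p => ‖g (p.1 + p.2) - g p.1‖ ^ 2 * singWeight s p.2 * N)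
    (Eventually.of_forall fun ε => Measurable.aestronglyMeasurable
      (by unfold rescale halfSqDiff; fun_prop))
    (Eventually.of_forall fun ε => ae_of_all _ fun p => ?_) (hg.diff.mul_const N) ?_
  · have := singWeight_nonneg s p.2
    rw [norm_mul, Real.norm_of_nonneg (by positivity)]
    gcongr
    exact hN _
  · filter_upwards [ae_halfSqDiff_ne_zero] with p hp
    refine tendsto_const_nhds.congr' ?_
    filter_upwards [Ioo_mem_nhdsGT (abs_pos.2 hp)] with ε hε
    rw [rescale, hζ.eq_zero, mul_zero]
    rw [abs_div, abs_of_pos hε.1, one_le_div hε.1]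
    exact hε.2.le

theorem fracEnergy_eq (δ : ℝ) (f : L2R) :
    fracEnergy δ f = ∫ ξ, |ξ| ^ (2 * δ) * ‖(𝓕 f : L2R) ξ‖ ^ 2 := by
  rw [fracEnergy]
  congr 1 with ξ
  rw [mul_pow, ← Real.rpow_mul_natCast (abs_nonneg ξ), mul_comm δ]
  norm_num

/-! ### The expansion of the pairing and its remainder in the three ranges of δ. -/

/-- The leading coefficient of the expansion. -/
noncomputable def leadingConst (δ : ℝ) (ζ : ℝ → ℝ) : ℝ :=
  2 * (gagliardoConst δ)⁻¹ * kernelConst δ ζ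

/-- The remainder profile of the expansion. -/
noncomputable def remainderProfile (δ : ℝ) (ζ : ℝ → ℝ) (x : ℝ) : ℝ :=
  2 * (gagliardoConst δ)⁻¹ * kernelRemainder δ ζ x

namespace IsSymmCutoff

variable {ζ : ℝ → ℝ} {δ : ℝ}

theorem measurable_remainderProfile (hζ : IsSymmCutoff ζ) (δ : ℝ) :
    Measurable (remainderProfile δ ζ) :=
  (hζ.isEvenBump.measurable_kernelRemainder δ).const_mul _

theorem exists_abs_remainderProfile_le (hζ : IsSymmCutoff ζ) {p : ℝ} (hδ₀ : 0 < δ) (hδ₁ : δ < 1)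
    (hp : p ≤ 0) (hp₁ : 2 * δ - 4 ≤ p) (hp₂ : -2 - 2 * δ ≤ p) :
    ∃ C, 0 ≤ C ∧ ∀ x, |remainderProfile δ ζ x| ≤ C * japan x ^ p := by
  obtain ⟨C, hC, h⟩ := hζ.exists_abs_kernelRemainder_le hδ₀ hδ₁ hp hp₁ hp₂
  refine ⟨|2 * (gagliardoConst δ)⁻¹| * C, by positivity, fun x => ?_⟩
  rw [remainderProfile, abs_mul, mul_assoc]
  exact mul_le_mul_of_nonneg_left (h x) (abs_nonneg _)

theorem integrable_mul_remainderProfile (hζ : IsSymmCutoff ζ) (hδ₀ : 0 < δ) (hδ₁ : δ < 1)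
    {F : ℝ → ℝ} (hF : Integrable F) (ε : ℝ) :
    Integrable fun ξ => F ξ * (ε ^ (-δ) * remainderProfile δ ζ (ξ / Real.sqrt ε)) := by
  obtain ⟨C, hC, h⟩ := hζ.exists_abs_remainderProfile_le (p := 0) hδ₀ hδ₁ le_rfl (by linarith)
    (by linarith)
  have hm := hζ.measurable_remainderProfile δ
  refine hF.mul_bdd (c := |ε ^ (-δ)| * C) (Measurable.aestronglyMeasurable (by fun_prop))
    (ae_of_all _ fun ξ => ?_)
  rw [norm_mul, Real.norm_eq_abs, Real.norm_eq_abs]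
  gcongr
  simpa using h (ξ / Real.sqrt ε)

/-- The exact expansion of the pairing. -/
theorem fourierPairing_rescale (hζ : IsSymmCutoff ζ) (hδ₀ : 0 < δ) (hδ₁ : δ < 1) {f : L2R}
    (hf : f ∈ SigmaSpace δ) {ε : ℝ} (hε : 0 < ε) :
    fourierPairing (dispersion δ f) (rescale ζ ε) =
      (((gagliardoConst δ)⁻¹ * localizedGagliardo δ (𝓕 f : L2R) (rescale ζ ε)
        + leadingConst δ ζ * ε ^ (-2 * δ) * fracEnergy δ f
        + ∫ ξ, ‖(𝓕 f : L2R) ξ‖ ^ 2 *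
            (ε ^ (-δ) * remainderProfile δ ζ (ξ / Real.sqrt ε)) : ℝ) : ℂ) := by
  have hg := isSobolevWeighted_fourier hδ₀ hδ₁ hf
  have hs : 0 < Real.sqrt ε := Real.sqrt_pos.2 hε
  have h1 (ξ : ℝ) : 2 * (gagliardoConst δ)⁻¹ *
      (‖(𝓕 f : L2R) ξ‖ ^ 2 * cutoffKernel δ (rescale ζ ε) ξ) =
      leadingConst δ ζ * ε ^ (-2 * δ) * (|ξ| ^ (2 * δ) * ‖(𝓕 f : L2R) ξ‖ ^ 2) +
        ‖(𝓕 f : L2R) ξ‖ ^ 2 * (ε ^ (-δ) * remainderProfile δ ζ (ξ / Real.sqrt ε)) := by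
    have h2 : ε ^ (-2 * δ) * |ξ| ^ (2 * δ) = ε ^ (-δ) * |ξ / Real.sqrt ε| ^ (2 * δ) := by
      rw [abs_div, abs_of_pos hs, Real.div_rpow (abs_nonneg _) hs.le, Real.sqrt_eq_rpow,
        ← Real.rpow_mul hε.le, show 1 / 2 * (2 * δ) = δ by ring,
        show -2 * δ = -δ + -δ by ring, Real.rpow_add hε, Real.rpow_neg hε.le]
      field_simp
    rw [cutoffKernel_rescale δ ζ hε, leadingConst, remainderProfile, kernelRemainder]
    linear_combination (-2 * (gagliardoConst δ)⁻¹ * kernelConst δ ζ * ‖(𝓕 f : L2R) ξ‖ ^ 2) * h2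
  rw [fourierPairing_dispersion hδ₀ hδ₁ hf (hζ.isEvenBump_rescale hε),
    hg.integral_pairedDiff hδ₀ hδ₁ (hζ.isEvenBump_rescale hε), fracEnergy_eq,
    ← integral_const_mul (leadingConst δ ζ * ε ^ (-2 * δ)), add_assoc,
    ← integral_add (hg.weighted.const_mul _) (hζ.integrable_mul_remainderProfile hδ₀ hδ₁ hg.sq ε),
    ← localizedGagliardo]
  simp_rw [← h1]
  rw [integral_const_mul]
  congr 1
  ring

theorem tendsto_inv_mul_localizedGagliardo (hζ : IsSymmCutoff ζ) (hδ₀ : 0 < δ) (hδ₁ : δ < 1)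
    {f : L2R} (hf : f ∈ SigmaSpace δ) :
    Tendsto (fun ε => (((gagliardoConst δ)⁻¹ *
      localizedGagliardo δ (𝓕 f : L2R) (rescale ζ ε) : ℝ) : ℂ)) (𝓝[>] 0) (𝓝 0) := by
  have h := (tendsto_localizedGagliardo (isSobolevWeighted_fourier hδ₀ hδ₁ hf) hζ).const_mul
    (gagliardoConst δ)⁻¹
  rw [mul_zero] at h
  exact (Complex.continuous_ofReal.tendsto' _ _ Complex.ofReal_zero).comp h

/-- In the subcritical range the remainder integral is negligible. -/
theorem tendsto_integral_remainderProfile (hζ : IsSymmCutoff ζ) (hδ₀ : 0 < δ) (hδ : δ < 1 / 2)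
    {f : L2R} (hf : f ∈ SigmaSpace δ) :
    Tendsto (fun ε => ∫ ξ, ‖(𝓕 f : L2R) ξ‖ ^ 2 *
      (ε ^ (-δ) * remainderProfile δ ζ (ξ / Real.sqrt ε))) (𝓝[>] 0) (𝓝 0) := by
  obtain ⟨C, hC, h⟩ := hζ.exists_abs_remainderProfile_le (p := -(2 * (δ + 1 / 2))) hδ₀
    (by linarith) (by linarith) (by linarith) (by linarith)
  have hm := hζ.measurable_remainderProfile δ
  have hg : Measurable ((𝓕 f : L2R) : ℝ → ℂ) := (Lp.stronglyMeasurable _).measurable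
  -- The exponent r is used twice: r = δ gives an ε-free majorant, integrable by Hardy, and r = δ +
  -- 1/2 gives pointwise decay ε^(1/2).
  have hbd (r : ℝ) (hr : 0 ≤ r) (hr' : r ≤ δ + 1 / 2) {ε ξ : ℝ} (hε : 0 < ε) (hξ : ξ ≠ 0) :
      |ε ^ (-δ) * remainderProfile δ ζ (ξ / Real.sqrt ε)| ≤
        C * (ε ^ (r - δ) * |ξ| ^ (-(2 * r))) := by
    rw [abs_mul, abs_of_pos (Real.rpow_pos_of_pos hε _)]
    have h1 : japan (ξ / Real.sqrt ε) ^ (-(2 * (δ + 1 / 2))) ≤ ε ^ r * |ξ| ^ (-(2 * r)) :=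
      (Real.rpow_le_rpow_of_exponent_le (one_le_japan _) (by linarith)).trans
        (japan_div_sqrt_rpow_le hr hε hξ)
    calc _ ≤ ε ^ (-δ) * (C * (ε ^ r * |ξ| ^ (-(2 * r)))) := by
          gcongr
          exact (h _).trans (by gcongr)
      _ = _ := by rw [sub_eq_add_neg, Real.rpow_add hε]; ring
  conv => arg 3; rw [← integral_zero ℝ ℝ (μ := volume)]
  refine tendsto_integral_filter_of_dominated_convergence
    (fun ξ => C * (|ξ| ^ (-(2 * δ)) * ‖(𝓕 f : L2R) ξ‖ ^ 2))
    (Eventually.of_forall fun ε => Measurable.aestronglyMeasurable (by fun_prop)) ?_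
    ((integrable_rpow_neg_mul_fourier hδ₀ hδ le_rfl hf).const_mul C) ?_
  · filter_upwards [self_mem_nhdsWithin] with ε hε
    filter_upwards [Measure.ae_ne volume (0 : ℝ)] with ξ hξ
    have h1 := hbd δ hδ₀.le (by linarith) hε hξ
    rw [sub_self, Real.rpow_zero, one_mul] at h1
    rw [norm_mul, Real.norm_of_nonneg (sq_nonneg _), Real.norm_eq_abs]
    calc _ ≤ ‖(𝓕 f : L2R) ξ‖ ^ 2 * (C * |ξ| ^ (-(2 * δ))) := by gcongr
      _ = _ := by ring
  · filter_upwards [Measure.ae_ne volume (0 : ℝ)] with ξ hξ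
    have h0 : Tendsto (fun ε : ℝ => ‖(𝓕 f : L2R) ξ‖ ^ 2 *
        (C * (ε ^ (1 / 2 : ℝ) * |ξ| ^ (-(2 * (δ + 1 / 2)))))) (𝓝[>] 0) (𝓝 0) := by
      have h2 : ContinuousAt (fun ε : ℝ => ε ^ (1 / 2 : ℝ)) 0 :=
        Real.continuousAt_rpow_const _ _ (Or.inr (by norm_num))
      have h3 : Tendsto (fun ε : ℝ => ε ^ (1 / 2 : ℝ)) (𝓝[>] 0) (𝓝 0) := by
        have := h2.tendsto.mono_left (nhdsWithin_le_nhds (s := Ioi (0 : ℝ)))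
        simpa using this
      simpa using ((h3.mul_const (|ξ| ^ (-(2 * (δ + 1 / 2))))).const_mul C).const_mul
        (‖(𝓕 f : L2R) ξ‖ ^ 2)
    refine squeeze_zero_norm' ?_ h0
    filter_upwards [self_mem_nhdsWithin] with ε hε
    have h1 := hbd (δ + 1 / 2) (by linarith) le_rfl hε hξ
    rw [add_sub_cancel_left] at h1
    rw [norm_mul, Real.norm_of_nonneg (sq_nonneg _), Real.norm_eq_abs]
    gcongr

theorem isBigO_integral_remainderProfile_half (hζ : IsSymmCutoff ζ) {f : L2R}
    (hf : f ∈ SigmaSpace (1 / 2)) {α : ℝ} (hα : 0 < α) :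
    (fun ε => ∫ ξ, ‖(𝓕 f : L2R) ξ‖ ^ 2 *
      (ε ^ (-(1 / 2) : ℝ) * remainderProfile (1 / 2) ζ (ξ / Real.sqrt ε)))
      =O[𝓝[>] 0] fun ε : ℝ => ε ^ (-α) := by
  obtain ⟨C, hC, h⟩ := hζ.exists_abs_remainderProfile_le (δ := 1 / 2) (p := -3) (by norm_num)
    (by norm_num) (by norm_num) (by norm_num) (by norm_num)
  set r : ℝ := max (1 / 4) (1 / 2 - α) with hr
  have hr0 : 0 < r := lt_max_of_lt_left (by norm_num)
  -- Hardy at order r leaves ε^(r-1/2), so r ≥ 1/2 - α is needed; the maximum with 1/4 keeps r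
  -- positive for large α.
  have hr1 : r < 1 / 2 := max_lt (by norm_num) (by linarith)
  have hr2 : 1 / 2 - α ≤ r := le_max_right _ _
  have hH := integrable_rpow_neg_mul_fourier hr0 hr1 hr1.le hf
  refine IsBigO.of_bound (C * ∫ ξ, |ξ| ^ (-(2 * r)) * ‖(𝓕 f : L2R) ξ‖ ^ 2) ?_
  filter_upwards [Ioo_mem_nhdsGT one_pos] with ε hε
  have hI : 0 ≤ ∫ ξ, |ξ| ^ (-(2 * r)) * ‖(𝓕 f : L2R) ξ‖ ^ 2 :=
    integral_nonneg fun ξ => by positivity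
  have hε0 : 0 < ε := hε.1
  have hpow : ε ^ (-(1 / 2) : ℝ) * ε ^ r ≤ ε ^ (-α) := by
    rw [← Real.rpow_add hε0]
    exact Real.rpow_le_rpow_of_exponent_ge hε0 hε.2.le (by linarith)
  rw [Real.norm_of_nonneg (by positivity : 0 ≤ ε ^ (-α))]
  calc _ ≤ ∫ ξ, C * (ε ^ (-(1 / 2) : ℝ) * ε ^ r) * (|ξ| ^ (-(2 * r)) * ‖(𝓕 f : L2R) ξ‖ ^ 2) := by
        refine norm_integral_le_of_norm_le (hH.const_mul _) ?_
        filter_upwards [Measure.ae_ne volume (0 : ℝ)] with ξ hξ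
        have h1 : japan (ξ / Real.sqrt ε) ^ (-3 : ℝ) ≤ ε ^ r * |ξ| ^ (-(2 * r)) :=
          (Real.rpow_le_rpow_of_exponent_le (one_le_japan _) (by linarith)).trans
            (japan_div_sqrt_rpow_le hr0.le hε0 hξ)
        rw [norm_mul, norm_mul, Real.norm_of_nonneg (sq_nonneg _),
          Real.norm_of_nonneg (by positivity : 0 ≤ ε ^ (-(1 / 2) : ℝ)), Real.norm_eq_abs]
        calc _ ≤ ‖(𝓕 f : L2R) ξ‖ ^ 2 *
              (ε ^ (-(1 / 2) : ℝ) * (C * (ε ^ r * |ξ| ^ (-(2 * r))))) := by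
              gcongr
              exact (h _).trans (by gcongr)
          _ = _ := by ring
    _ = C * (ε ^ (-(1 / 2) : ℝ) * ε ^ r) * ∫ ξ, |ξ| ^ (-(2 * r)) * ‖(𝓕 f : L2R) ξ‖ ^ 2 :=
        integral_const_mul _ _
    _ ≤ C * ε ^ (-α) * ∫ ξ, |ξ| ^ (-(2 * r)) * ‖(𝓕 f : L2R) ξ‖ ^ 2 := by gcongr
    _ = _ := by ring

/-- The decay exponent 2δ - 4 < -1 makes the profile integrable, and rescaling its integral gives
ε^(1/2-δ). -/
theorem integral_remainderProfile_split (hζ : IsSymmCutoff ζ) (hδ : 1 / 2 < δ) (hδ₁ : δ < 1)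
    {F : ℝ → ℝ} (hF : Integrable F) (c : ℝ) {ε : ℝ} (hε : 0 < ε) :
    ∫ ξ, F ξ * (ε ^ (-δ) * remainderProfile δ ζ (ξ / Real.sqrt ε)) =
      (∫ x, remainderProfile δ ζ x) * ε ^ (1 / 2 - δ) * c +
        ∫ ξ, (F ξ - c) * (ε ^ (-δ) * remainderProfile δ ζ (ξ / Real.sqrt ε)) := by
  have hδ₀ : 0 < δ := by linarith
  have hs : 0 < Real.sqrt ε := Real.sqrt_pos.2 hε
  obtain ⟨C, hC, h⟩ := hζ.exists_abs_remainderProfile_le (p := 2 * δ - 4) hδ₀ hδ₁ (by linarith)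
    le_rfl (by linarith)
  have hR : Integrable (remainderProfile δ ζ) :=
    ((integrable_japan_rpow (p := 2 * δ - 4) (by linarith)).const_mul C).mono'
      (hζ.measurable_remainderProfile δ).aestronglyMeasurable (ae_of_all _ h)
  have h1 : Integrable fun ξ => c * (ε ^ (-δ) * remainderProfile δ ζ (ξ / Real.sqrt ε)) :=
    ((hR.comp_div hs.ne').const_mul _).const_mul _
  have h2 := hζ.integrable_mul_remainderProfile hδ₀ hδ₁ hF ε
  simp_rw [sub_mul]
  rw [integral_sub h2 h1, integral_const_mul, integral_const_mul,
    Measure.integral_comp_div (remainderProfile δ ζ), abs_of_pos hs, smul_eq_mul,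
    show 1 / 2 - δ = -δ + 1 / 2 by ring, Real.rpow_add hε, ← Real.sqrt_eq_rpow]
  ring

/-- After rescaling, the Hölder bound gives ε^((δ-1/2)/2), the prefactor ε^(-δ) and the Jacobian
ε^(1/2). The profile absorbs the factor |x|^(δ-1/2) because 3δ - 9/2 < -1. -/
theorem isBigO_integral_sub_mul_remainderProfile (hζ : IsSymmCutoff ζ) (hδ : 1 / 2 < δ)
    (hδ₁ : δ < 1) {f : L2R} (hf : f ∈ SigmaSpace δ) :
    (fun ε => ∫ ξ, (‖(𝓕 f : L2R) ξ‖ ^ 2 - ‖fourierAtZero f‖ ^ 2) *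
      (ε ^ (-δ) * remainderProfile δ ζ (ξ / Real.sqrt ε)))
      =O[𝓝[>] 0] fun ε : ℝ => ε ^ (-((δ - 1 / 2) / 2)) := by
  have hδ₀ : 0 < δ := by linarith
  obtain ⟨C, hC, h⟩ := hζ.exists_abs_remainderProfile_le (p := 2 * δ - 4) hδ₀ hδ₁ (by linarith)
    le_rfl (by linarith)
  have hi := integrable_of_mem_sigmaSpace hδ hf
  obtain ⟨C', hC', h'⟩ := exists_norm_fourier_sub_fourier_zero_le hδ hδ₁ hf
  set M := ∫ x, ‖f x‖ with hM
  have hM0 : 0 ≤ M := integral_nonneg fun x => norm_nonneg _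
  have hle (ξ : ℝ) : ‖𝓕 (f : ℝ → ℂ) ξ‖ ≤ M :=
    VectorFourier.norm_fourierIntegral_le_integral_norm _ _ _ _ _
  have hdiff (ξ : ℝ) : |‖𝓕 (f : ℝ → ℂ) ξ‖ ^ 2 - ‖fourierAtZero f‖ ^ 2| ≤
      2 * M * (C' * |ξ| ^ (δ - 1 / 2)) := by
    rw [sq_sub_sq, abs_mul, abs_of_nonneg (by positivity), fourierAtZero]
    exact mul_le_mul (by linarith [hle ξ, hle 0]) ((abs_norm_sub_norm_le _ _).trans (h' ξ))
      (abs_nonneg _) (by positivity)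
  set P : ℝ → ℝ := fun x => |x| ^ (δ - 1 / 2) * japan x ^ (2 * δ - 4) with hP
  have hP0 (x : ℝ) : 0 ≤ P x :=
    mul_nonneg (by positivity) (Real.rpow_nonneg (zero_le_one.trans (one_le_japan x)) _)
  have hPi : Integrable P := by
    have hm := measurable_japan
    refine (integrable_japan_rpow (p := 3 * δ - 9 / 2) (by linarith)).mono'
      (Measurable.aestronglyMeasurable (by fun_prop)) (ae_of_all _ fun x => ?_)
    have hj : 0 < japan x := zero_lt_one.trans_le (one_le_japan x)
    rw [Real.norm_of_nonneg (hP0 x), show 3 * δ - 9 / 2 = (δ - 1 / 2) + (2 * δ - 4) by ring,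
      Real.rpow_add hj]
    have := Real.rpow_le_rpow (abs_nonneg x) (abs_le_japan x) (by linarith : 0 ≤ δ - 1 / 2)
    simp only [hP]
    gcongr
  refine IsBigO.of_bound (2 * M * C' * C * ∫ x, P x) ?_
  filter_upwards [self_mem_nhdsWithin] with ε hε
  have hε0 : 0 < ε := hε
  have hs : 0 < Real.sqrt ε := Real.sqrt_pos.2 hε0
  rw [Real.norm_of_nonneg (by positivity : 0 ≤ ε ^ (-((δ - 1 / 2) / 2)))]
  calc _ ≤ ∫ ξ, 2 * M * C' * C * (ε ^ ((δ - 1 / 2) / 2) * ε ^ (-δ)) * P (ξ / Real.sqrt ε) := by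
        refine norm_integral_le_of_norm_le ((hPi.comp_div hs.ne').const_mul _) ?_
        filter_upwards [fourier_ae_eq_of_integrable hi] with ξ hξ
        have h1 : |ξ| ^ (δ - 1 / 2) = ε ^ ((δ - 1 / 2) / 2) * |ξ / Real.sqrt ε| ^ (δ - 1 / 2) := by
          rw [abs_div, abs_of_pos hs, Real.div_rpow (abs_nonneg _) hs.le, Real.sqrt_eq_rpow,
            ← Real.rpow_mul hε0.le, show 1 / 2 * (δ - 1 / 2) = (δ - 1 / 2) / 2 by ring]
          field_simp
        rw [hξ, norm_mul, norm_mul, Real.norm_eq_abs, Real.norm_eq_abs (remainderProfile δ ζ _),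
          Real.norm_of_nonneg (by positivity : 0 ≤ ε ^ (-δ))]
        calc _ ≤ 2 * M * (C' * |ξ| ^ (δ - 1 / 2)) *
              (ε ^ (-δ) * (C * japan (ξ / Real.sqrt ε) ^ (2 * δ - 4))) := by
              gcongr
              · exact hdiff ξ
              · exact h _
          _ = _ := by rw [h1]; simp only [hP]; ring
    _ = 2 * M * C' * C * (ε ^ ((δ - 1 / 2) / 2) * ε ^ (-δ) * Real.sqrt ε) * ∫ x, P x := by
        rw [integral_const_mul, Measure.integral_comp_div P, abs_of_pos hs, smul_eq_mul]
        ring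
    _ = _ := by
        rw [Real.sqrt_eq_rpow, ← Real.rpow_add hε0, ← Real.rpow_add hε0,
          show (δ - 1 / 2) / 2 + -δ + 1 / 2 = -((δ - 1 / 2) / 2) by ring]
        ring

end IsSymmCutoff

theorem isBigO_rpow_neg_of_tendsto_zero {E : ℝ → ℂ} (hE : Tendsto E (𝓝[>] 0) (𝓝 0)) {α : ℝ}
    (hα : 0 ≤ α) : E =O[𝓝[>] 0] fun ε : ℝ => ε ^ (-α) := by
  refine (hE.isBigO_one ℝ).trans (IsBigO.of_bound 1 ?_)
  filter_upwards [Ioo_mem_nhdsGT one_pos] with ε hε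
  have hε0 : 0 < ε := hε.1
  rw [norm_one, one_mul, Real.norm_of_nonneg (by positivity)]
  exact Real.one_le_rpow_of_pos_of_le_one_of_nonpos hε0 hε.2.le (by linarith)

theorem mainTheorem9 (δ : ℝ) (hδ₀ : 0 < δ) (hδ₁ : δ < 1) (ζ : ℝ → ℝ) (hζ : IsSymmCutoff ζ) :
    -- the dispersion functional and its pairing with the cutoffs are given by convergent integrals
    (∀ f ∈ SigmaSpace δ,
      (∀ t : ℝ, Integrable (fun x : ℝ => |x| ^ (2 * δ) * ‖schrodingerSol f t x‖ ^ 2)) ∧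
      (∀ ε : ℝ, 0 < ε → Integrable (fun t : ℝ =>
        (dispersion δ f t : ℂ) * 𝓕 (fun τ : ℝ => (rescale ζ ε τ : ℂ)) t))) ∧
    (δ < 1 / 2 → ∃ A : ℝ, ∀ f ∈ SigmaSpace δ,
      (fun ε : ℝ => fourierPairing (dispersion δ f) (rescale ζ ε)
          - ((A * ε ^ (-2 * δ) * fracEnergy δ f : ℝ) : ℂ))
        =o[𝓝[>] 0] (fun _ => (1 : ℝ))) ∧
    (δ = 1 / 2 → ∃ (A : ℝ) (R : ℝ → ℝ), Measurable R ∧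
      (∃ C : ℝ, ∀ ξ, |R ξ| ≤ C * japan ξ ^ (-3 : ℝ)) ∧
      ∀ f ∈ SigmaSpace δ,
        (fun ε : ℝ => fourierPairing (dispersion δ f) (rescale ζ ε)
            - ((A * ε ^ (-1 : ℝ) * fracEnergy δ f
              + ∫ ξ : ℝ, ‖(𝓕 f : L2R) ξ‖ ^ 2
                  * (ε ^ (-(1 / 2) : ℝ) * R (ξ / Real.sqrt ε)) : ℝ) : ℂ))
          =o[𝓝[>] 0] (fun _ => (1 : ℝ)) ∧
        ∀ α : ℝ, 0 < α →
          (fun ε : ℝ => fourierPairing (dispersion δ f) (rescale ζ ε)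
              - ((A * ε ^ (-1 : ℝ) * fracEnergy δ f : ℝ) : ℂ))
            =O[𝓝[>] 0] (fun ε : ℝ => ε ^ (-α))) ∧
    (1 / 2 < δ → ∃ (A B : ℝ) (R : ℝ → ℝ), Measurable R ∧
      (∃ C : ℝ, ∀ ξ, |R ξ| ≤ C * japan ξ ^ (2 * δ - 4)) ∧
      ∀ f ∈ SigmaSpace δ,
        Integrable (f : ℝ → ℂ) ∧
        (fun ε : ℝ => fourierPairing (dispersion δ f) (rescale ζ ε)
            - ((A * ε ^ (-2 * δ) * fracEnergy δ f
              + B * ε ^ (1 / 2 - δ) * ‖fourierAtZero f‖ ^ 2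
              + ∫ ξ : ℝ, (‖(𝓕 f : L2R) ξ‖ ^ 2 - ‖fourierAtZero f‖ ^ 2)
                  * (ε ^ (-δ) * R (ξ / Real.sqrt ε)) : ℝ) : ℂ))
          =o[𝓝[>] 0] (fun _ => (1 : ℝ)) ∧
        (fun ε : ℝ => fourierPairing (dispersion δ f) (rescale ζ ε)
            - ((A * ε ^ (-2 * δ) * fracEnergy δ f
              + B * ε ^ (1 / 2 - δ) * ‖fourierAtZero f‖ ^ 2 : ℝ) : ℂ))
          =O[𝓝[>] 0] (fun ε : ℝ => ε ^ (-((δ - 1 / 2) / 2)))) := by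
  have hI : ∀ f ∈ SigmaSpace δ, ∀ α : ℝ, 0 ≤ α → _ := fun f hf α hα =>
    isBigO_rpow_neg_of_tendsto_zero
      (hζ.tendsto_inv_mul_localizedGagliardo hδ₀ hδ₁ hf) hα
  have hbig {J : ℝ → ℝ} {b : ℝ → ℝ} (h : J =O[𝓝[>] 0] b) :
      (fun ε => (J ε : ℂ)) =O[𝓝[>] 0] b :=
    IsBigO.of_norm_left (by simpa using h.norm_left)
  refine ⟨fun f hf => ⟨fun t => (dispersion_eq hδ₀ hδ₁ hf t).1, fun ε hε =>
    integrable_dispersion_mul_fourier hδ₀ hδ₁ hf (hζ.isEvenBump_rescale hε)⟩, fun hδ => ?_,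
    fun hδ => ?_, fun hδ => ?_⟩
  · refine ⟨leadingConst δ ζ, fun f hf => (isLittleO_one_iff ℝ).2 ?_⟩
    have h := (hζ.tendsto_inv_mul_localizedGagliardo hδ₀ hδ₁ hf).add
      ((Complex.continuous_ofReal.tendsto _).comp (hζ.tendsto_integral_remainderProfile hδ₀ hδ hf))
    rw [Complex.ofReal_zero, add_zero] at h
    refine h.congr' ?_
    filter_upwards [self_mem_nhdsWithin] with ε hε
    rw [hζ.fourierPairing_rescale hδ₀ hδ₁ hf hε, Function.comp_apply, ← Complex.ofReal_add,
      ← Complex.ofReal_sub]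
    congr 1
    ring
  · subst hδ
    obtain ⟨C, -, hC⟩ := hζ.exists_abs_remainderProfile_le (p := -3) hδ₀ hδ₁ (by norm_num)
      (by norm_num) (by norm_num)
    refine ⟨leadingConst (1 / 2) ζ, remainderProfile (1 / 2) ζ,
      hζ.measurable_remainderProfile _, ⟨C, hC⟩, fun f hf =>
        ⟨(isLittleO_one_iff ℝ).2 ?_, fun α hα => ?_⟩⟩
    -- With the remainder integral kept in the expansion, the error is exactly the localized
    -- Gagliardo term.
    · refine (hζ.tendsto_inv_mul_localizedGagliardo hδ₀ hδ₁ hf).congr' ?_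
      filter_upwards [self_mem_nhdsWithin] with ε hε
      rw [hζ.fourierPairing_rescale hδ₀ hδ₁ hf hε, ← Complex.ofReal_sub,
        show (-2 : ℝ) * (1 / 2) = -1 by norm_num]
      congr 1
      ring
    · refine ((hI f hf α hα.le).add
        (hbig (hζ.isBigO_integral_remainderProfile_half hf hα))).congr' ?_ EventuallyEq.rfl
      filter_upwards [self_mem_nhdsWithin] with ε hε
      rw [hζ.fourierPairing_rescale hδ₀ hδ₁ hf hε, ← Complex.ofReal_sub, ← Complex.ofReal_add,
        show (-2 : ℝ) * (1 / 2) = -1 by norm_num]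
      congr 1
      ring
  · obtain ⟨C, -, hC⟩ := hζ.exists_abs_remainderProfile_le (p := 2 * δ - 4) hδ₀ hδ₁
      (by linarith) le_rfl (by linarith)
    refine ⟨leadingConst δ ζ, ∫ x, remainderProfile δ ζ x, remainderProfile δ ζ,
      hζ.measurable_remainderProfile _, ⟨C, hC⟩, fun f hf =>
        ⟨integrable_of_mem_sigmaSpace hδ hf, (isLittleO_one_iff ℝ).2 ?_, ?_⟩⟩
    · refine (hζ.tendsto_inv_mul_localizedGagliardo hδ₀ hδ₁ hf).congr' ?_
      filter_upwards [self_mem_nhdsWithin] with ε hε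
      rw [hζ.fourierPairing_rescale hδ₀ hδ₁ hf hε, ← Complex.ofReal_sub,
        hζ.integral_remainderProfile_split hδ hδ₁
          (isSobolevWeighted_fourier hδ₀ hδ₁ hf).sq (‖fourierAtZero f‖ ^ 2) hε]
      congr 1
      ring
    · refine ((hI f hf ((δ - 1 / 2) / 2) (by linarith)).add
        (hbig (hζ.isBigO_integral_sub_mul_remainderProfile hδ hδ₁ hf))).congr' ?_ EventuallyEq.rfl
      filter_upwards [self_mem_nhdsWithin] with ε hε
      rw [hζ.fourierPairing_rescale hδ₀ hδ₁ hf hε, ← Complex.ofReal_sub, ← Complex.ofReal_add,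
        hζ.integral_remainderProfile_split hδ hδ₁
          (isSobolevWeighted_fourier hδ₀ hδ₁ hf).sq (‖fourierAtZero f‖ ^ 2) hε]
      congr 1
      ring
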